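/- Let $\mathbb{F}_q$ be a finite field with $q$ elements (so $q$ is a prime power), let $n\ge 0$, and write $[n]=\{1,\dots,n\}$. Let $\mathfrak{F}$ be the set of complete flags $A=(V_0\subseteq V_1\subseteq\cdots\subseteq V_n)$ of subspaces of $\mathbb{F}_q^n$ with $\dim V_i=i$. For a field $K$ of characteristic $0$ and $\mathsf{x}=(x_1,\dots,x_n)\in K^n$, consider the following operators acting from the right on $K[\mathfrak{F}]$, the $K$-vector space with basis $\mathfrak{F}$. * For $1\le i\le n-1$, the Hecke generator $T_i$: $A\cdot T_i=\sum_{W}(V_0\subseteq\cdots\subseteq V_{i-1}\subseteq W\subseteq V_{i+1}\subseteq\cdots\subseteq V_n)$, the sum over all subspaces $W\ne V_i$ with $V_{i-1}\subseteq W\subseteq V_{i+1}$ and $\dim W=i$. * The weight operator $\mathcal{X}(q,\mathsf{x})$: $A\cdot\mathcal{X}(q,\mathsf{x})=\frac{x_i}{q^{n-i}}\,A$, where $i$ is the unique index such that $V_1=\langle e_i+\sum_{k>i}c_ke_k\rangle$ for some $c_k\in\mathbb{F}_q$. The $q$-Tsetlin library on flags is the operator $$\mathcal{T}(q,\mathsf{x})=\Big(\sum_{i=1}^n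 T_{i-1}T_{i-2}\cdots T_1\Big)\,\mathcal{X}(q,\mathsf{x}),$$ where the term $i=1$ in the sum is the identity. If $K=\mathbb{R}$, $n\ge 1$, all $x_i\ge 0$ and $x_1+\cdots+x_n=1$, its matrix is the transition matrix of a Markov chain on $\mathfrak{F}$. Let $[m]_q=1+q+\cdots+q^{m-1}$, $[m]_q!=[1]_q[2]_q\cdots[m]_q$, and let $d_m(q)=[m]_q!\sum_{k=0}^m\frac{(-1)^k}{[k]_q!}q^{\binom{k}{2}}$ be the $q$-derangement numbers. For $S=\{i_1>i_2>\cdots>i_k\}\subseteq[n]$ put $$\lambda_S(q,\mathsf{x})=\sum_{j=1}^k\frac{x_{i_j}}{q^{\,n-i_j-j+1}},\qquad m_S=\begin{cases} d_{n-k}(q)\,q^{\sum_{j=1}^k(n-j+1-i_j)} & \text{if } k\ne n,\\ 1 & \text{if } k=n.\end{cases}$$ **Theorem.** Every $m_S$ is a nonnegative integer (possibly $0$), and for every field $K$ of characteristic $0$ and every $\mathsf{x}\in K^n$ the eigenvalues of $\mathcal{T}(q,\mathsf{x})$ are the $\lambda_S(q,\mathsf{x})$ with algebraic multiplicity $m_S$,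 one for each $S\subseteq[n]$ (multiplicities being added if values coincide); that is, its characteristic polynomial is $\prod_{S\subseteq[n]}\big(t-\lambda_S(q,\mathsf{x})\big)^{m_S}$. Moreover, $\mathcal{T}(q,\mathsf{x})$ is diagonalizable over $\mathbb{R}$ whenever $x_1,\dots,x_n$ are nonnegative real numbers, and it is diagonalizable over the field of rational functions $\mathbb{C}(x_1,\dots,x_n)$ when $x_1,\dots,x_n$ are indeterminates. -/

import Mathlib

open scoped Classical

namespace QTsetlin

noncomputable section

/-- A complete flag `V_0 ⊆ V_1 ⊆ ⋯ ⊆ V_n` in `𝔽^n`, with `dim V_i = i`. -/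
@[ext]
structure CompleteFlag (𝔽 : Type*) [Field 𝔽] (n : ℕ) where
  V : Fin (n + 1) → Submodule 𝔽 (Fin n → 𝔽)
  mono : Monotone V
  finrank_eq : ∀ i, Module.finrank 𝔽 (V i) = (i : ℕ)

instance instFiniteCompleteFlag (𝔽 : Type*) [Field 𝔽] [Finite 𝔽] (n : ℕ) :
    Finite (CompleteFlag 𝔽 n) :=
  Finite.of_injective (fun A : CompleteFlag 𝔽 n => A.V) (fun _ _ h => CompleteFlag.ext h)

instance instFintypeCompleteFlag (𝔽 : Type*) [Field 𝔽] [Finite 𝔽] (n : ℕ) :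
    Fintype (CompleteFlag 𝔽 n) :=
  Fintype.ofFinite _

section Operators

variable (𝔽 : Type*) [Field 𝔽] [Fintype 𝔽] (n : ℕ) (K : Type*) [Field K]

/- All operators act from the right on formal `K`-linear combinations of flags.  They are written
as matrices whose `(A, B)` entry is the coefficient of the flag `B` in `A · T`, so that acting by
`T` and then by `T'` is the matrix product `T * T'`. -/

/-- The Hecke generator `T_i` (for `1 ≤ i ≤ n - 1`): `A · T_i` is the sum of all complete flags
that differ from `A` in the `i`-th subspace and only there. -/
def heckeT (i : ℕ) : Matrix (CompleteFlag 𝔽 n) (CompleteFlag 𝔽 n) K :=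
  Matrix.of fun A B =>
    if (∀ j : Fin (n + 1), (j : ℕ) ≠ i → B.V j = A.V j) ∧ B ≠ A then 1 else 0

/-- The product `T_m T_{m-1} ⋯ T_1` (the identity for `m = 0`). -/
def heckeWord : ℕ → Matrix (CompleteFlag 𝔽 n) (CompleteFlag 𝔽 n) K
  | 0 => 1
  | m + 1 => heckeT 𝔽 n K (m + 1) * heckeWord m

variable {𝔽 n K}

/-- `L` is the line spanned by `e_i + ∑_{k > i} c_k e_k` for some scalars `c_k`. -/
def HasLeadingIndex (L : Submodule 𝔽 (Fin n → 𝔽)) (i : Fin n) : Prop :=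
  ∃ v : Fin n → 𝔽, v i = 1 ∧ (∀ k, k < i → v k = 0) ∧ L = Submodule.span 𝔽 {v}

/-- The weight `x_i / q^{n-i}` of a flag whose line `V_1` has leading index `i`.  Every line has
exactly one leading index, so exactly one summand contributes.  The index `i : Fin n` stands for
the number `i + 1` in `{1, …, n}`. -/
def flagWeight (x : Fin n → K) (A : CompleteFlag 𝔽 n) : K :=
  ∑ i : Fin n,
    if HasLeadingIndex (A.V 1) i then x i / (Fintype.card 𝔽 : K) ^ (n - ((i : ℕ) + 1)) else 0

variable (𝔽)

/-- The diagonal operator that multiplies each flag by its weight. -/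
def weightOp (x : Fin n → K) : Matrix (CompleteFlag 𝔽 n) (CompleteFlag 𝔽 n) K :=
  Matrix.diagonal (flagWeight x)

/-- The transition matrix `(∑_{i=1}^n T_{i-1} ⋯ T_1) · 𝒳` of the `q`-Tsetlin library on flags. -/
def tsetlin (x : Fin n → K) : Matrix (CompleteFlag 𝔽 n) (CompleteFlag 𝔽 n) K :=
  (∑ m ∈ Finset.range n, heckeWord 𝔽 n K m) * weightOp 𝔽 x

end Operators

/-- For `i ∈ S = {i_1 > i_2 > ⋯ > i_k}`, the position `j` with `i = i_j`. -/
def position {n : ℕ} (S : Finset (Fin n)) (i : Fin n) : ℕ :=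
  (S.filter fun t => i ≤ t).card

/-- The number `n - j + 1 - i_j` for `i = i_j ∈ S`.  It is never negative, since `S` has `j`
elements in `{i_j, …, n}`; so the subtraction is exact. -/
def expo {n : ℕ} (S : Finset (Fin n)) (i : Fin n) : ℕ :=
  n + 1 - (position S i + ((i : ℕ) + 1))

/-- `λ_S(q, x) = ∑_j x_{i_j} / q^{n - i_j - j + 1}`. -/
def eigenvalue {n : ℕ} {K : Type*} [Field K] (q : ℕ) (x : Fin n → K) (S : Finset (Fin n)) : K :=
  ∑ i ∈ S, x i / (q : K) ^ expo S i

/-- `[m]_q = 1 + q + ⋯ + q^{m-1}`. -/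
def qInt (q m : ℕ) : ℚ := ∑ r ∈ Finset.range m, (q : ℚ) ^ r

/-- `[m]_q! = [1]_q [2]_q ⋯ [m]_q`. -/
def qFactorial (q m : ℕ) : ℚ := ∏ r ∈ Finset.range m, qInt q (r + 1)

/-- The `q`-derangement number `d_m(q)`. -/
def qDerangement (q m : ℕ) : ℚ :=
  qFactorial q m *
    ∑ k ∈ Finset.range (m + 1), (-1 : ℚ) ^ k / qFactorial q k * (q : ℚ) ^ (k.choose 2)

/-- The multiplicity attached to `S`. -/
def multiplicity {n : ℕ} (q : ℕ) (S : Finset (Fin n)) : ℚ :=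
  if S.card = n then 1
  else qDerangement q (n - S.card) * (q : ℚ) ^ (∑ i ∈ S, expo S i)

/-- A square matrix over a field is diagonalizable if it is conjugate to a diagonal matrix. -/
def IsDiagonalizable {ι K : Type*} [Fintype ι] [Field K] (M : Matrix ι ι K) : Prop :=
  ∃ (P : Matrix ι ι K) (d : ι → K), IsUnit P ∧ M * P = P * Matrix.diagonal d

end

end QTsetlin

/-! Inserting a vector `v` in front of a flag `A` gives the flag with subspaces `0` and `A_i + ⟨v⟩`.
Applying `T_m ⋯ T_1` to `A` inserts exactly the lines that lie in `A_{m+1}` but not in `A_m`, so the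
sum over `m` inserts every line once, and `𝒯` is a weighted sum of insertions (`tsetlin_eq_sum`).
Once a word of vectors has been inserted, what was inserted earlier from its span no longer matters
(`insertWord_insert`). This absorption law drives everything else.

Spectrum: the number of flags fixed by a word depends only on its span `X`. It is `[n - dim X]_q!`,
which equals the sum of `d_{n - dim Y}` over all `Y ⊇ X` (`fixCount_eq_sum`). Peeling off letters
one at a time turns this into `tr 𝒯^t = ∑_Y d_{n - dim Y} w(Y)^t`, where `w(Y)` is the total weight
of the vectors of `Y` (`trace_walk_pow`). In characteristic 0 the power sums determine the
characteristic polynomial (`charpoly_eq_of_trace_pow`). Finally the subspaces are grouped by their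
pivot set `S`, as in reduced echelon form: `w(Y) = λ_S` (`subspaceWeight_vecWeight`), and `q^{∑
expo}` subspaces share the pivots `S` (`pivotCount_eq`).

Diagonalizability: multiplying a word operator by `𝒯 - w(X)`, with `X` the span of the word, leaves
only words of larger span. If `w` changes whenever a vector of nonzero weight enlarges a subspace,
the product of `𝒯 - μ` over the distinct values `μ` of `w` vanishes (`isDiagonalizable_walk`). This
holds for nonnegative weights and for indeterminates. -/

namespace QTsetlin

noncomputable section

/-! ### q-factorials and q-derangement numbers. -/

section QNumbers

theorem qInt_add (q a b : ℕ) : qInt q (a + b) = qInt q a + (q : ℚ) ^ a * qInt q b := by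
  simp only [qInt, Finset.sum_range_add, Finset.mul_sum, pow_add]

theorem qInt_mul (q m : ℕ) : qInt q m * ((q : ℚ) - 1) = (q : ℚ) ^ m - 1 :=
  geom_sum_mul _ _

theorem pow_sub_pow_eq_mul_qInt (q k m : ℕ) :
    (q : ℚ) ^ (k + m) - (q : ℚ) ^ k = (q : ℚ) ^ k * ((q : ℚ) - 1) * qInt q m := by
  rw [mul_assoc, mul_comm _ (qInt _ _), qInt_mul, pow_add]
  ring

theorem qInt_succ_pos (q m : ℕ) : 0 < qInt q (m + 1) := by
  rw [add_comm, qInt_add]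
  have h : 0 ≤ (q : ℚ) ^ 1 * qInt q m :=
    mul_nonneg (by positivity) (Finset.sum_nonneg fun _ _ => by positivity)
  have : qInt q 1 = 1 := by simp [qInt]
  linarith

theorem qFactorial_zero (q : ℕ) : qFactorial q 0 = 1 := by simp [qFactorial]

theorem qFactorial_succ (q m : ℕ) : qFactorial q (m + 1) = qFactorial q m * qInt q (m + 1) :=
  Finset.prod_range_succ _ _

theorem qFactorial_pos (q m : ℕ) : 0 < qFactorial q m :=
  Finset.prod_pos fun _ _ => qInt_succ_pos _ _

theorem qDerangement_zero (q : ℕ) : qDerangement q 0 = 1 := by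
  simp [qDerangement, qFactorial]

theorem qDerangement_succ (q m : ℕ) :
    qDerangement q (m + 1) =
      qInt q (m + 1) * qDerangement q m + (-1) ^ (m + 1) * (q : ℚ) ^ ((m + 1).choose 2) := by
  have := (qFactorial_pos q (m + 1)).ne'
  rw [qDerangement, Finset.sum_range_succ, mul_add, qDerangement]
  congr 1
  · rw [qFactorial_succ]; ring
  · field_simp

/-- The recursion subtracts `q ^ (m + 1).choose 2` exactly when `m` is even. The lower bound for
even `m` is carried along to keep that difference nonnegative, using `[m+1]_q ≥ q^m`. -/
theorem exists_nat_eq_qDerangement (q : ℕ) (m : ℕ) :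
    ∃ d : ℕ, (d : ℚ) = qDerangement q m ∧ (Even m → q ^ m.choose 2 ≤ d) := by
  induction m with
  | zero => exact ⟨1, by simp [qDerangement_zero]⟩
  | succ m ih =>
    obtain ⟨d, hd, hle⟩ := ih
    have hcast : ((∑ r ∈ Finset.range (m + 1), q ^ r : ℕ) : ℚ) = qInt q (m + 1) := by
      simp [qInt]
    rcases Nat.even_or_odd m with hm | hm
    · have h1 : q ^ (m + 1).choose 2 ≤ (∑ r ∈ Finset.range (m + 1), q ^ r) * d := by
        calc q ^ (m + 1).choose 2 = q ^ m * q ^ m.choose 2 := by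
              rw [← pow_add, Nat.choose_succ_succ' m 1, Nat.choose_one_right]
          _ ≤ _ := Nat.mul_le_mul
              (Finset.single_le_sum (f := fun r => q ^ r) (fun _ _ => Nat.zero_le _)
                (Finset.self_mem_range_succ m)) (hle hm)
      refine ⟨(∑ r ∈ Finset.range (m + 1), q ^ r) * d - q ^ (m + 1).choose 2, ?_, fun h => ?_⟩
      · rw [Nat.cast_sub h1, Nat.cast_mul, hcast, hd, qDerangement_succ, hm.add_one.neg_one_pow]
        push_cast
        ring
      · exact absurd h (Nat.not_even_iff_odd.2 hm.add_one)
    · refine ⟨(∑ r ∈ Finset.range (m + 1), q ^ r) * d + q ^ (m + 1).choose 2, ?_, fun _ =>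
        Nat.le_add_left _ _⟩
      rw [Nat.cast_add, Nat.cast_mul, hcast, hd, qDerangement_succ, hm.add_one.neg_one_pow]
      push_cast
      ring

/-- The `q`-derangement number as a natural number. -/
def natDerangement (q m : ℕ) : ℕ := (exists_nat_eq_qDerangement q m).choose

theorem natDerangement_cast (q m : ℕ) : (natDerangement q m : ℚ) = qDerangement q m :=
  (exists_nat_eq_qDerangement q m).choose_spec.1

/-- The q-analogue of `∑_{k ≤ s} (-1)^k C(N,k) = (-1)^s C(N-1,s)` with `N = s + 1 + u`. Truncated
sums have a closed form and so allow an induction, unlike the full alternating sum. -/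
theorem sum_neg_one_pow_div_qFactorial_mul (q s u : ℕ) :
    qInt q (s + 1 + u) * ∑ k ∈ Finset.range (s + 1),
      (-1 : ℚ) ^ k / qFactorial q k * (q : ℚ) ^ (k.choose 2) / qFactorial q (s + 1 + u - k) =
    (-1) ^ s * (q : ℚ) ^ ((s + 1).choose 2) / (qFactorial q s * qFactorial q u) := by
  induction s generalizing u with
  | zero =>
    have h1 := (qFactorial_pos q u).ne'
    have h2 := (qInt_succ_pos q u).ne'
    simp [qFactorial_zero, add_comm 1 u, qFactorial_succ]
    field_simp
  | succ s ih =>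
    have e1 : s + 1 + 1 + u = s + 1 + (u + 1) := by omega
    have e2 : s + 1 + (u + 1) - (s + 1) = u + 1 := by omega
    rw [Finset.sum_range_succ, mul_add, e1, ih (u + 1), e2, qInt_add q (s + 1) (u + 1),
      qFactorial_succ q u, qFactorial_succ q s, Nat.choose_succ_succ' (s + 1) 1,
      Nat.choose_one_right, pow_add, pow_succ]
    have h1 := (qFactorial_pos q u).ne'
    have h2 := (qFactorial_pos q s).ne'
    have h3 := (qInt_succ_pos q u).ne'
    have h4 := (qInt_succ_pos q s).ne'
    field_simp
    ring

theorem sum_neg_one_pow_div_qFactorial (q r : ℕ) :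
    ∑ k ∈ Finset.range (r + 1 + 1),
      (-1 : ℚ) ^ k / qFactorial q k * (q : ℚ) ^ (k.choose 2) / qFactorial q (r + 1 - k) = 0 := by
  apply (mul_eq_zero.1 (?_ : qInt q (r + 1) * _ = 0)).resolve_left (qInt_succ_pos q r).ne'
  have := sum_neg_one_pow_div_qFactorial_mul q r 0
  rw [Nat.add_zero] at this
  rw [Finset.sum_range_succ, mul_add, this, Nat.sub_self, qFactorial_zero, qFactorial_succ]
  have h2 := (qFactorial_pos q r).ne'
  have h4 := (qInt_succ_pos q r).ne'
  field_simp
  ring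

/-- This is `[m]_q! = ∑_j binom(m,j)_q d_{m-j}` divided by `[m]_q!`. Passing from `m` to `m + 1`
adds one term to each inner sum and one new outer term; together they form the vanishing alternating
sum. -/
theorem sum_qDerangement_div (q m : ℕ) :
    ∑ j ∈ Finset.range (m + 1),
      qDerangement q (m - j) / (qFactorial q j * qFactorial q (m - j)) = 1 := by
  have hS (m j : ℕ) : qDerangement q (m - j) / (qFactorial q j * qFactorial q (m - j)) =
      (∑ k ∈ Finset.range (m - j + 1), (-1 : ℚ) ^ k / qFactorial q k * (q : ℚ) ^ (k.choose 2)) /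
        qFactorial q j := by
    have h1 := (qFactorial_pos q j).ne'
    have h2 := (qFactorial_pos q (m - j)).ne'
    rw [qDerangement]
    field_simp
  simp only [hS]
  induction m with
  | zero => simp [qFactorial_zero]
  | succ m ih =>
    refine Eq.trans ?_ ih
    rw [Finset.sum_range_succ]
    have e : ∀ j ∈ Finset.range (m + 1), m + 1 - j + 1 = (m - j + 1) + 1 := fun j hj => by
      have := Finset.mem_range.1 hj
      omega
    rw [Finset.sum_congr rfl fun j hj => by rw [e j hj, Finset.sum_range_succ, add_div],
      Finset.sum_add_distrib, add_assoc, add_eq_left]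
    have := sum_neg_one_pow_div_qFactorial q m
    rw [← Finset.sum_range_reflect, Finset.sum_range_succ] at this
    rw [← this]
    congr 1
    · refine Finset.sum_congr rfl fun j hj => ?_
      have := Finset.mem_range.1 hj
      have e1 : m + 1 + 1 - 1 - j = m - j + 1 := by omega
      have e2 : m + 1 - (m - j + 1) = j := by omega
      rw [e1, e2]
    · simp

end QNumbers

/-! ### Inserting vectors in front of flags. -/

section Action

variable {𝔽 : Type*} [Field 𝔽] {n : ℕ}

open Submodule Module

instance instFintypeSubmodule [Finite 𝔽] : Fintype (Submodule 𝔽 (Fin n → 𝔽)) :=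
  Fintype.ofFinite _

namespace CompleteFlag

theorem V_zero (A : CompleteFlag 𝔽 n) : A.V 0 = ⊥ :=
  Submodule.finrank_eq_zero.1 (by simpa using A.finrank_eq 0)

theorem V_last (A : CompleteFlag 𝔽 n) : A.V (Fin.last n) = ⊤ :=
  Submodule.eq_top_of_finrank_eq (by simpa using A.finrank_eq (Fin.last n))

theorem V_eq_of_le {A B : CompleteFlag 𝔽 n} {j : Fin (n + 1)} (h : A.V j ≤ B.V j) :
    A.V j = B.V j :=
  Submodule.eq_of_le_of_finrank_eq h (by rw [A.finrank_eq, B.finrank_eq])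

/-- Dimensions recover the indices, so flags can be compared as sets of subspaces. This avoids the
index shift that insertion causes. -/
theorem ext_range {A B : CompleteFlag 𝔽 n} (h : Set.range A.V ⊆ Set.range B.V) : A = B := by
  ext1
  funext j
  obtain ⟨k, hk⟩ := h ⟨j, rfl⟩
  have := congrArg (fun W : Submodule 𝔽 (Fin n → 𝔽) => finrank 𝔽 W) hk
  simp only [A.finrank_eq, B.finrank_eq, Fin.val_inj] at this
  rw [← hk, this]

theorem V_succ_eq_sup (A : CompleteFlag 𝔽 n) {i : Fin n} {v : Fin n → 𝔽}
    (h : v ∉ A.V i.castSucc) (h' : v ∈ A.V i.succ) :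
    A.V i.castSucc ⊔ span 𝔽 {v} = A.V i.succ := by
  refine Submodule.eq_of_le_of_finrank_eq
    (sup_le (A.mono (Fin.castSucc_le_succ i)) (by simpa using h')) ?_
  rw [finrank_sup_span_singleton h, A.finrank_eq, A.finrank_eq]
  simp

/-- The subspaces of the flag obtained from `A` by inserting the vector `v` in front. -/
def insertV (v : Fin n → 𝔽) (A : CompleteFlag 𝔽 n) (j : Fin (n + 1)) :
    Submodule 𝔽 (Fin n → 𝔽) :=
  -- If `v ∉ A_j`, then `A_j + ⟨v⟩` has dimension `j + 1`, so place `j` is filled by `A_{j-1} +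
  -- ⟨v⟩`, and place `0` by `⊥`.
  if v ∈ A.V j then A.V j else Fin.cases ⊥ (fun i => A.V i.castSucc ⊔ span 𝔽 {v}) j

theorem insertV_of_mem {v : Fin n → 𝔽} {A : CompleteFlag 𝔽 n} {j : Fin (n + 1)}
    (h : v ∈ A.V j) : insertV v A j = A.V j := if_pos h

theorem insertV_zero (v : Fin n → 𝔽) (A : CompleteFlag 𝔽 n) : insertV v A 0 = ⊥ := by
  unfold insertV
  split_ifs
  · exact A.V_zero
  · rfl

theorem insertV_succ {v : Fin n → 𝔽} {A : CompleteFlag 𝔽 n} {i : Fin n}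
    (h : v ∉ A.V i.succ) : insertV v A i.succ = A.V i.castSucc ⊔ span 𝔽 {v} := by
  simp [insertV, h]

/-- The flag obtained from `A` by inserting the vector `v` in front: its subspaces are `0` and
the `A_i + ⟨v⟩`. -/
def insert (v : Fin n → 𝔽) (A : CompleteFlag 𝔽 n) : CompleteFlag 𝔽 n where
  V := insertV v A
  mono := by
    intro j k hjk
    by_cases hj : v ∈ A.V j
    · rw [insertV_of_mem hj, insertV_of_mem (A.mono hjk hj)]
      exact A.mono hjk
    induction j using Fin.cases with
    | zero => simp [insertV_zero]
    | succ i =>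
      rw [insertV_succ hj]
      by_cases hk : v ∈ A.V k
      · rw [insertV_of_mem hk]
        exact sup_le (A.mono ((Fin.castSucc_le_succ i).trans hjk)) (by simpa using hk)
      · induction k using Fin.cases with
        | zero => simp at hjk
        | succ l =>
          rw [insertV_succ hk]
          exact sup_le_sup_right
            (A.mono (Fin.castSucc_le_castSucc_iff.2 (Fin.succ_le_succ_iff.1 hjk))) _
  finrank_eq := by
    intro j
    by_cases hj : v ∈ A.V j
    · rw [insertV_of_mem hj, A.finrank_eq]
    induction j using Fin.cases with
    | zero => simp [insertV_zero]
    | succ i =>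
      have hi : v ∉ A.V i.castSucc := fun h => hj (A.mono (Fin.castSucc_le_succ i) h)
      rw [insertV_succ hj, finrank_sup_span_singleton hi, A.finrank_eq]
      simp

theorem insert_V (v : Fin n → 𝔽) (A : CompleteFlag 𝔽 n) : (insert v A).V = insertV v A := rfl

theorem range_insert (v : Fin n → 𝔽) (A : CompleteFlag 𝔽 n) :
    Set.range (insert v A).V = Insert.insert ⊥ (Set.range fun i => A.V i ⊔ span 𝔽 {v}) := by
  rw [insert_V]
  apply subset_antisymm
  · rintro _ ⟨j, rfl⟩
    by_cases hj : v ∈ A.V j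
    · right
      exact ⟨j, by rw [insertV_of_mem hj]; simpa using hj⟩
    induction j using Fin.cases with
    | zero => left; rw [insertV_zero]
    | succ i => right; exact ⟨i.castSucc, (insertV_succ hj).symm⟩
  · rintro _ (rfl | ⟨j, rfl⟩)
    · exact ⟨0, insertV_zero v A⟩
    · by_cases hj : v ∈ A.V j
      · exact ⟨j, by rw [insertV_of_mem hj]; symm; simpa using hj⟩
      induction j using Fin.lastCases with
      | last => simp [V_last] at hj
      | cast i =>
        refine ⟨i.succ, ?_⟩
        by_cases hi : v ∈ A.V i.succ
        · rw [insertV_of_mem hi]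
          exact (A.V_succ_eq_sup hj hi).symm
        · rw [insertV_succ hi]

/-- Inserting the letters of a word in front, the first letter last. -/
def insertWord (ℓ : List (Fin n → 𝔽)) (A : CompleteFlag 𝔽 n) : CompleteFlag 𝔽 n :=
  ℓ.foldr insert A

theorem insertWord_append (ℓ ℓ' : List (Fin n → 𝔽)) (A : CompleteFlag 𝔽 n) :
    insertWord (ℓ ++ ℓ') A = insertWord ℓ (insertWord ℓ' A) :=
  List.foldr_append

/-- The span of the letters of a word. -/
def wordSpan (ℓ : List (Fin n → 𝔽)) : Submodule 𝔽 (Fin n → 𝔽) := span 𝔽 {v | v ∈ ℓ}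

theorem wordSpan_nil : wordSpan ([] : List (Fin n → 𝔽)) = ⊥ := by simp [wordSpan]

theorem wordSpan_cons (v : Fin n → 𝔽) (ℓ : List (Fin n → 𝔽)) :
    wordSpan (v :: ℓ) = wordSpan ℓ ⊔ span 𝔽 {v} := by
  rw [wordSpan, wordSpan, ← span_union]
  congr 1
  ext
  simp

theorem wordSpan_append_singleton (v : Fin n → 𝔽) (ℓ : List (Fin n → 𝔽)) :
    wordSpan (ℓ ++ [v]) = wordSpan ℓ ⊔ span 𝔽 {v} := by
  rw [wordSpan, wordSpan, ← span_union]
  congr 1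
  ext
  simp [or_comm]

/-- The subspaces that every flag of the form `insertWord ℓ A` contains. -/
def prefixSet : List (Fin n → 𝔽) → Set (Submodule 𝔽 (Fin n → 𝔽))
  | [] => ∅
  | v :: ℓ => Insert.insert ⊥ ((fun W => W ⊔ span 𝔽 {v}) '' prefixSet ℓ)

/-- The flag `A` enters only through its joins with the span of the word; the remaining subspaces
come from the word alone. -/
theorem range_insertWord (ℓ : List (Fin n → 𝔽)) (A : CompleteFlag 𝔽 n) :
    Set.range (insertWord ℓ A).V = prefixSet ℓ ∪ Set.range fun i => A.V i ⊔ wordSpan ℓ := by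
  induction ℓ with
  | nil => simp [insertWord, prefixSet, wordSpan_nil]
  | cons v ℓ ih =>
    have : insertWord (v :: ℓ) A = insert v (insertWord ℓ A) := rfl
    have h : (Set.range fun i => (insertWord ℓ A).V i ⊔ span 𝔽 {v}) =
        (fun W => W ⊔ span 𝔽 {v}) '' Set.range (insertWord ℓ A).V := by
      rw [← Set.range_comp]; rfl
    rw [this, range_insert, h, ih, Set.image_union, prefixSet, Set.insert_union, ← Set.range_comp]
    simp only [Function.comp_def, sup_assoc, wordSpan_cons]

/-- The absorption law: `A_i + ⟨v⟩` and `A_i` have the same join with a span that contains `v`. -/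
theorem insertWord_insert {ℓ : List (Fin n → 𝔽)} {v : Fin n → 𝔽} (hv : v ∈ wordSpan ℓ)
    (A : CompleteFlag 𝔽 n) : insertWord ℓ (insert v A) = insertWord ℓ A := by
  apply ext_range
  rw [range_insertWord, range_insertWord]
  apply Set.union_subset_union_right
  rintro _ ⟨j, rfl⟩
  have hj : (insert v A).V j ∈ Set.range (insert v A).V := ⟨j, rfl⟩
  rw [range_insert] at hj
  rcases hj with hj | ⟨i, hi⟩
  · exact ⟨0, by simp only [hj, A.V_zero]⟩
  · refine ⟨i, ?_⟩
    simp only at hi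
    simp only [← hi, sup_assoc]
    rw [sup_eq_right.2 (by simpa using hv : span 𝔽 {v} ≤ wordSpan ℓ)]

theorem insertWord_insertWord {ℓ ℓ' : List (Fin n → 𝔽)} (h : ∀ v ∈ ℓ', v ∈ wordSpan ℓ)
    (A : CompleteFlag 𝔽 n) : insertWord ℓ (insertWord ℓ' A) = insertWord ℓ A := by
  induction ℓ' with
  | nil => rfl
  | cons v ℓ' ih =>
    have : insertWord (v :: ℓ') A = insert v (insertWord ℓ' A) := rfl
    rw [this, insertWord_insert (h v (by simp)), ih fun v hv => h v (by simp [hv])]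

theorem insertWord_self (ℓ : List (Fin n → 𝔽)) (A : CompleteFlag 𝔽 n) :
    insertWord ℓ (insertWord ℓ A) = insertWord ℓ A :=
  insertWord_insertWord (fun _ hv => subset_span hv) A

theorem sup_wordSpan_mem_range {ℓ : List (Fin n → 𝔽)} {A : CompleteFlag 𝔽 n}
    (h : insertWord ℓ A = A) (i : Fin (n + 1)) : A.V i ⊔ wordSpan ℓ ∈ Set.range A.V := by
  have : A.V i ⊔ wordSpan ℓ ∈ Set.range (insertWord ℓ A).V := by
    rw [range_insertWord]
    exact Or.inr ⟨i, rfl⟩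
  rwa [h] at this

/-- A flag fixed by a word passes through the span of the word, since that span is the join with
`A_0 = 0`. -/
theorem V_finrank_wordSpan {ℓ : List (Fin n → 𝔽)} {A : CompleteFlag 𝔽 n}
    (h : insertWord ℓ A = A) {k : Fin (n + 1)} (hk : finrank 𝔽 (wordSpan ℓ) = k) :
    A.V k = wordSpan ℓ := by
  obtain ⟨j, hj⟩ := sup_wordSpan_mem_range h 0
  rw [A.V_zero, bot_sup_eq] at hj
  have := A.finrank_eq j
  rw [hj, hk, Fin.val_inj] at this
  rw [this, hj]

/-- A word extended by a vector outside its span fixes the flags that the word fixes and whose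
next subspace contains the vector. -/
theorem insertWord_append_singleton_eq_self {ℓ : List (Fin n → 𝔽)} {v : Fin n → 𝔽}
    (hv : v ∉ wordSpan ℓ) {k : Fin n} (hk : finrank 𝔽 (wordSpan ℓ) = k)
    (A : CompleteFlag 𝔽 n) :
    insertWord (ℓ ++ [v]) A = A ↔ insertWord ℓ A = A ∧ v ∈ A.V k.succ := by
  constructor
  · intro h
    have h2 : insertWord ℓ A = A := by
      conv_lhs => rw [← h]
      rw [insertWord_append, insertWord_self, ← insertWord_append, h]
    refine ⟨h2, ?_⟩
    rw [V_finrank_wordSpan h (k := k.succ)]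
    · exact subset_span (by simp)
    · rw [wordSpan_append_singleton, finrank_sup_span_singleton hv, hk]
      simp
  · rintro ⟨h, h2⟩
    have hX := V_finrank_wordSpan (k := k.castSucc) h (by simpa using hk)
    have hX2 := A.V_succ_eq_sup (by rwa [hX]) h2
    rw [hX] at hX2
    apply ext_range
    rw [insertWord_append, range_insertWord]
    nth_rw 2 [← h]
    rw [range_insertWord]
    apply Set.union_subset_union_right
    rintro _ ⟨j, rfl⟩
    have hj : (insertWord [v] A).V j ∈ Set.range (insertWord [v] A).V := ⟨j, rfl⟩
    rw [show insertWord [v] A = insert v A from rfl, range_insert] at hj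
    rcases hj with hj | ⟨i, hi⟩
    · exact ⟨0, by simp only [show insertWord [v] A = insert v A from rfl, hj, A.V_zero]⟩
    · simp only at hi
      -- Since `span ℓ + ⟨v⟩ = A_{k+1}`, the join of `A_i` with both is `A_i + A_{k+1}`, the larger
      -- of two members of the chain.
      refine ⟨i ⊔ k.succ, ?_⟩
      simp only [show insertWord [v] A = insert v A from rfl, ← hi]
      have hle : wordSpan ℓ ≤ A.V k.succ := hX ▸ A.mono (Fin.castSucc_le_succ k)
      rw [sup_assoc, sup_comm (span 𝔽 {v}), hX2, A.mono.map_sup, sup_assoc, sup_eq_left.2 hle]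

/-- The standard complete flag. -/
def standard (𝔽 : Type*) [Field 𝔽] (n : ℕ) : CompleteFlag 𝔽 n where
  V i := span 𝔽 ((fun k : Fin n => Pi.basisFun 𝔽 (Fin n) k) '' {k | (k : ℕ) < i})
  mono _ _ h := span_mono (Set.image_mono fun k (hk : (k : ℕ) < _) =>
    (lt_of_lt_of_le hk h : (k : ℕ) < _))
  finrank_eq i := by
    rw [finrank_span_set_eq_card]
    · rw [Set.toFinset_image, Finset.card_image_of_injective _ (Basis.injective _)]
      have := i.2
      rw [Set.toFinset_ofPred, Fin.card_filter_val_lt]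
      omega
    · exact ((Pi.basisFun 𝔽 (Fin n)).linearIndependent.linearIndepOn _).id_image

instance : Nonempty (CompleteFlag 𝔽 n) := ⟨standard 𝔽 n⟩

end CompleteFlag

end Action

/-! ### The Tsetlin operator as a weighted sum of insertions. -/

section Words

variable {𝔽 : Type*} [Field 𝔽] {n : ℕ}

open Submodule Module

/-- For `n = 0` the literal `1 : Fin (n + 1)` equals `0`, so `V 1` is a line only when `n` is
positive. -/
theorem val_one_of_pos (hn : 0 < n) : ((1 : Fin (n + 1)) : ℕ) = 1 := by
  obtain ⟨n, rfl⟩ := Nat.exists_eq_add_of_lt hn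
  rw [Fin.val_one', Nat.mod_eq_of_lt (by omega)]

/-- The flags `B` that occur in `A · T_m ⋯ T_1`. -/
def IsHeckeWordTerm (m : ℕ) (A B : CompleteFlag 𝔽 n) : Prop :=
  (∀ j : Fin (n + 1), m < j → B.V j = A.V j) ∧
    (∀ i : Fin n, (i : ℕ) < m → A.V i.castSucc ≤ B.V i.succ) ∧
      ∀ j : Fin (n + 1), (j : ℕ) = m → ¬ B.V 1 ≤ A.V j

/-- The flag `A` with its `i`-th subspace replaced by `W`. -/
def CompleteFlag.replace (A : CompleteFlag 𝔽 n) (i : Fin (n + 1))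
    (W : Submodule 𝔽 (Fin n → 𝔽)) (hW : finrank 𝔽 W = i) (h₁ : ∀ j < i, A.V j ≤ W)
    (h₂ : ∀ j, i < j → W ≤ A.V j) : CompleteFlag 𝔽 n where
  V := Function.update A.V i W
  mono := by
    intro j k hjk
    rcases eq_or_ne j i with rfl | hj <;> rcases eq_or_ne k j with rfl | hk
    · exact le_rfl
    · simpa [hk] using h₂ k (lt_of_le_of_ne hjk hk.symm)
    · exact le_rfl
    · rcases eq_or_ne k i with rfl | hk'
      · simpa [hj] using h₁ j (lt_of_le_of_ne hjk hj)
      · simpa [hj, hk'] using A.mono hjk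
  finrank_eq j := by
    rcases eq_or_ne j i with rfl | hj
    · rwa [Function.update_self]
    · rw [Function.update_of_ne hj, A.finrank_eq]

theorem isHeckeWordTerm_zero {A B : CompleteFlag 𝔽 n} (hn : 0 < n) :
    IsHeckeWordTerm 0 A B ↔ A = B := by
  constructor
  · rintro ⟨h, -⟩
    ext1
    funext j
    rcases Nat.eq_zero_or_pos (j : ℕ) with hj | hj
    · rw [Fin.ext hj (b := 0), A.V_zero, B.V_zero]
    · exact (h j hj).symm
  · rintro rfl
    refine ⟨fun _ _ => rfl, fun i hi => absurd hi (by omega), fun j hj h => ?_⟩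
    have : (j : Fin (n + 1)) = 0 := Fin.ext hj
    rw [this, A.V_zero] at h
    have h1 := A.finrank_eq 1
    rw [le_bot_iff.1 h, finrank_bot, val_one_of_pos (by omega)] at h1
    omega

/-- The intermediate flag must be `A` with its subspace of dimension `m + 1` replaced by that of
`B`. -/
theorem isHeckeWordTerm_succ {m : ℕ} (hm : m + 1 < n) {A B : CompleteFlag 𝔽 n} :
    IsHeckeWordTerm (m + 1) A B ↔
      ∃ C, ((∀ j : Fin (n + 1), (j : ℕ) ≠ m + 1 → C.V j = A.V j) ∧ C ≠ A) ∧
        IsHeckeWordTerm m C B := by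
  have one_le : (1 : Fin (n + 1)) ≤ ⟨m + 1, by omega⟩ := by
    rw [Fin.le_def, val_one_of_pos (by omega)]
    exact Nat.le_add_left _ _
  constructor
  · rintro ⟨h₁, h₂, h₃⟩
    have hB := B.finrank_eq ⟨m + 1, by omega⟩
    have hlow : ∀ j < (⟨m + 1, by omega⟩ : Fin (n + 1)), A.V j ≤ B.V ⟨m + 1, by omega⟩ :=
      fun j hj => (A.mono (Fin.le_def.2 (Nat.lt_succ_iff.1 hj))).trans
        (h₂ ⟨m, by omega⟩ (by simp))
    have hhigh : ∀ j, (⟨m + 1, by omega⟩ : Fin (n + 1)) < j → B.V ⟨m + 1, by omega⟩ ≤ A.V j := by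
      intro j hj
      rw [← h₁ j hj]
      exact B.mono hj.le
    refine ⟨A.replace ⟨m + 1, by omega⟩ (B.V ⟨m + 1, by omega⟩) hB hlow hhigh,
      ⟨?_, ?_⟩, ?_, ?_, ?_⟩
    · intro j hj
      exact Function.update_of_ne (fun h => hj (congrArg Fin.val h)) _ _
    · intro h
      apply h₃ ⟨m + 1, by omega⟩ rfl
      conv_rhs => rw [← h]
      simpa [CompleteFlag.replace] using B.mono one_le
    · intro j hj
      rcases eq_or_ne j ⟨m + 1, by omega⟩ with hj' | hj'
      · rw [hj']
        exact (Function.update_self (β := fun _ => Submodule 𝔽 (Fin n → 𝔽)) _ _ _).symm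
      · have : (j : ℕ) ≠ m + 1 := fun h => hj' (Fin.ext h)
        rw [h₁ j (by omega)]
        exact (Function.update_of_ne hj' _ _).symm
    · intro i hi
      have : (A.replace ⟨m + 1, by omega⟩ (B.V ⟨m + 1, by omega⟩) hB hlow hhigh).V i.castSucc =
          A.V i.castSucc :=
        Function.update_of_ne (fun h => by have := congrArg Fin.val h; simp at this; omega) _ _
      rw [this]
      exact h₂ i (by omega)
    · intro j hj
      have : (A.replace ⟨m + 1, by omega⟩ (B.V ⟨m + 1, by omega⟩) hB hlow hhigh).V j = A.V j :=
        Function.update_of_ne (fun h => by have := congrArg Fin.val h; simp at this; omega) _ _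
      rw [this]
      exact fun h => h₃ ⟨m + 1, by omega⟩ rfl (h.trans (A.mono (Fin.le_def.2 (by simp [hj]))))
  · rintro ⟨C, ⟨hC, hne⟩, h₁, h₂, h₃⟩
    refine ⟨?_, ?_, ?_⟩
    · intro j hj
      rw [h₁ j (by omega), hC j (by omega)]
    · intro i hi
      rw [← hC i.castSucc (by simp; omega)]
      rcases Nat.lt_succ_iff_lt_or_eq.1 hi with h | h
      · exact h₂ i h
      · rw [h₁ i.succ (by simp [h])]
        exact C.mono (Fin.castSucc_le_succ i)
    · intro j hj hle
      -- If `B_1 ≤ A_{m+1}`, then `A_{m+1}` and `C_{m+1}` are both spanned by the common subspace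
      -- `A_m = C_m` and a vector of `B_1` outside it.
      apply hne
      have hBj : B.V j = C.V j := h₁ j (by omega)
      have hle2 : B.V 1 ≤ C.V j := by
        rw [← hBj]; exact B.mono (by rwa [← Fin.ext hj (b := ⟨m + 1, by omega⟩)] at one_le)
      let i : Fin n := ⟨m, by omega⟩
      have hji : j = i.succ := Fin.ext hj
      have hi := h₃ i.castSucc rfl
      obtain ⟨u, hu, hu'⟩ := SetLike.not_le_iff_exists.1 hi
      have e1 := C.V_succ_eq_sup hu' (hji ▸ hle2 hu)
      have hi2 : C.V i.castSucc = A.V i.castSucc := hC _ (by simp [i])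
      have e2 := A.V_succ_eq_sup (hi2 ▸ hu') (hji ▸ hle hu)
      ext1
      funext k
      by_cases hk : (k : ℕ) = m + 1
      · have : k = i.succ := Fin.ext hk
        rw [this, ← e1, ← e2, hi2]
      · exact hC k hk

/-- The intermediate flag is forced by `A` and `B`, so no coefficient exceeds 1. -/
theorem heckeWord_apply [Fintype 𝔽] {K : Type*} [Field K] {m : ℕ} (hm : m < n)
    (A B : CompleteFlag 𝔽 n) :
    heckeWord 𝔽 n K m A B = if IsHeckeWordTerm m A B then 1 else 0 := by
  induction m generalizing A with
  | zero => simp only [heckeWord, Matrix.one_apply, isHeckeWordTerm_zero hm]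
  | succ m ih =>
    simp only [heckeWord, Matrix.mul_apply, heckeT, Matrix.of_apply, ih (by omega), ← ite_and,
      mul_ite, mul_one, mul_zero]
    split_ifs with h
    · obtain ⟨C, hC⟩ := (isHeckeWordTerm_succ hm).1 h
      rw [Finset.sum_eq_single C, if_pos ⟨hC.2, hC.1⟩]
      · rintro D - hD
        refine if_neg fun h' => hD ?_
        ext1
        funext j
        by_cases hj : (j : ℕ) = m + 1
        · rw [← hC.2.1 j (by omega), ← h'.1.1 j (by omega)]
        · rw [hC.1.1 j hj, h'.2.1 j hj]
      · simp
    · refine Finset.sum_eq_zero fun C _ => if_neg fun h' => h ?_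
      exact (isHeckeWordTerm_succ hm).2 ⟨C, h'.2, h'.1⟩

/-- Up to the place where `u` enters `A`, each `B_{i+1}` contains `A_i` and `u`, hence equals their
join by dimension; from that place on the flags agree. -/
theorem isHeckeWordTerm_iff {A B : CompleteFlag 𝔽 n} {u : Fin n → 𝔽} (hu : B.V 1 = span 𝔽 {u})
    (m : Fin n) :
    IsHeckeWordTerm m A B ↔
      B = CompleteFlag.insert u A ∧ u ∉ A.V m.castSucc ∧ u ∈ A.V m.succ := by
  have one_le (i : Fin n) : (1 : Fin (n + 1)) ≤ i.succ := by
    rw [Fin.le_def, val_one_of_pos (by have := i.2; omega)]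
    simp
  have huB (i : Fin n) : u ∈ B.V i.succ :=
    B.mono (one_le i) (hu ▸ mem_span_singleton_self u)
  constructor
  · rintro ⟨h₁, h₂, h₃⟩
    have hm : u ∉ A.V m.castSucc := by
      have := h₃ m.castSucc rfl
      rwa [hu, span_singleton_le_iff_mem] at this
    have hm' : u ∈ A.V m.succ := by
      rw [← h₁ m.succ (by simp)]
      exact huB m
    refine ⟨?_, hm, hm'⟩
    ext1
    funext j
    rw [CompleteFlag.insert_V]
    by_cases hj : u ∈ A.V j
    · rw [CompleteFlag.insertV_of_mem hj]
      refine h₁ j (lt_of_not_ge fun hle => hm (A.mono ?_ hj))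
      exact hle
    · have hle : (j : ℕ) ≤ m := by
        by_contra hlt
        exact hj (A.mono (Fin.le_def.2 (by simp; omega)) hm')
      induction j using Fin.cases with
      | zero => rw [CompleteFlag.insertV_zero, B.V_zero]
      | succ i =>
        symm
        rw [← CompleteFlag.insert_V]
        apply CompleteFlag.V_eq_of_le
        rw [CompleteFlag.insert_V, CompleteFlag.insertV_succ hj]
        exact sup_le (h₂ i (by simpa using hle)) (by simpa using huB i)
  · rintro ⟨rfl, hm, hm'⟩
    refine ⟨fun j hj => ?_, fun i hi => ?_, fun j hj h => ?_⟩
    · exact CompleteFlag.insertV_of_mem (A.mono (Fin.le_def.2 (by simpa using hj)) hm')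
    · have : u ∉ A.V i.succ := fun h => hm (A.mono (Fin.le_def.2 (by simpa using hi)) h)
      rw [CompleteFlag.insert_V, CompleteFlag.insertV_succ this]
      exact le_sup_left
    · rw [hu, span_singleton_le_iff_mem] at h
      exact hm ((Fin.ext hj : j = m.castSucc) ▸ h)

/-- The first nonzero entry of `v` is at `i`. -/
def Leads (v : Fin n → 𝔽) (i : Fin n) : Prop := v i ≠ 0 ∧ ∀ k < i, v k = 0

theorem hasLeadingIndex_span_iff {v : Fin n → 𝔽} (hv : v ≠ 0) {i : Fin n} :
    HasLeadingIndex (span 𝔽 {v}) i ↔ Leads v i := by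
  constructor
  · rintro ⟨w, hw, hw', h⟩
    have : v ∈ span 𝔽 {w} := h ▸ mem_span_singleton_self v
    obtain ⟨a, rfl⟩ := mem_span_singleton.1 this
    have ha : a ≠ 0 := by rintro rfl; simp at hv
    exact ⟨by simp [hw, ha], fun k hk => by simp [hw' k hk]⟩
  · rintro ⟨h, h'⟩
    refine ⟨(v i)⁻¹ • v, by simp [h], fun k hk => by simp [h' k hk], ?_⟩
    exact (span_singleton_smul_eq (IsUnit.mk0 _ (inv_ne_zero h)) v).symm

theorem insert_eq_insert_of_span_eq {u v : Fin n → 𝔽} (h : span 𝔽 {u} = span 𝔽 {v})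
    (A : CompleteFlag 𝔽 n) : CompleteFlag.insert u A = CompleteFlag.insert v A := by
  apply CompleteFlag.ext_range
  rw [CompleteFlag.range_insert, CompleteFlag.range_insert, h]

theorem insert_V_one (hn : 0 < n) {v : Fin n → 𝔽} (hv : v ≠ 0) (A : CompleteFlag 𝔽 n) :
    (CompleteFlag.insert v A).V 1 = span 𝔽 {v} := by
  have : span 𝔽 {v} ∈ Set.range (CompleteFlag.insert v A).V := by
    rw [CompleteFlag.range_insert]
    exact Or.inr ⟨0, by simp [A.V_zero]⟩
  obtain ⟨j, hj⟩ := this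
  have h := (CompleteFlag.insert v A).finrank_eq j
  rw [hj, finrank_span_singleton hv] at h
  rw [← hj]
  congr 1
  apply Fin.ext
  rw [← h, val_one_of_pos hn]

section Operator

variable [Fintype 𝔽] {K : Type*} [Field K]

/-- The weight of a vector: the weight of its line, divided equally among the nonzero vectors of
the line. -/
def vecWeight (x : Fin n → K) (v : Fin n → 𝔽) : K :=
  ∑ i : Fin n, if Leads v i then
    x i / (Fintype.card 𝔽 : K) ^ (n - ((i : ℕ) + 1)) / ((Fintype.card 𝔽 : K) - 1) else 0

/-- The matrix of the map that inserts `v` in front of a flag. -/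
def insertMatrix (K : Type*) [Field K] (v : Fin n → 𝔽) :
    Matrix (CompleteFlag 𝔽 n) (CompleteFlag 𝔽 n) K :=
  Matrix.of fun A B => if B = CompleteFlag.insert v A then 1 else 0

theorem vecWeight_zero (x : Fin n → K) : vecWeight x (0 : Fin n → 𝔽) = 0 := by
  simp [vecWeight, Leads]

theorem flagWeight_eq [CharZero K] (x : Fin n → K) {B : CompleteFlag 𝔽 n} {u : Fin n → 𝔽}
    (hu : B.V 1 = span 𝔽 {u}) (hu0 : u ≠ 0) :
    flagWeight x B = ((Fintype.card 𝔽 : K) - 1) * vecWeight x u := by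
  have hq : (Fintype.card 𝔽 : K) - 1 ≠ 0 := by
    rw [sub_ne_zero]
    exact_mod_cast (Fintype.one_lt_card (α := 𝔽)).ne'
  simp only [flagWeight, vecWeight, hu, hasLeadingIndex_span_iff hu0, Finset.mul_sum, mul_ite,
    mul_zero]
  refine Finset.sum_congr rfl fun i _ => ?_
  congr 1
  rw [mul_div_cancel₀ _ hq]

theorem sum_heckeWord_apply (A B : CompleteFlag 𝔽 n) {u : Fin n → 𝔽}
    (hu : B.V 1 = span 𝔽 {u}) (hu0 : u ≠ 0) :
    (∑ m ∈ Finset.range n, heckeWord 𝔽 n K m) A B =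
      if B = CompleteFlag.insert u A then 1 else 0 := by
  rw [Matrix.sum_apply, Finset.sum_congr rfl fun m hm =>
    heckeWord_apply (K := K) (Finset.mem_range.1 hm) A B, ← Fin.sum_univ_eq_sum_range
      (fun m => if IsHeckeWordTerm m A B then (1 : K) else 0)]
  simp only [isHeckeWordTerm_iff hu]
  split_ifs with h
  · have hex : ∃ m : Fin n, u ∉ A.V m.castSucc ∧ u ∈ A.V m.succ := by
      by_contra! hcon
      have : ∀ j : Fin (n + 1), u ∉ A.V j := fun j => by
        induction j using Fin.induction with
        | zero => simpa [A.V_zero] using hu0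
        | succ i ih => exact hcon i ih
      exact this (Fin.last n) (by simp [A.V_last])
    obtain ⟨m, hm⟩ := hex
    rw [Finset.sum_eq_single m, if_pos ⟨h, hm⟩]
    · rintro k - hk
      refine if_neg fun hk' => ?_
      rcases lt_or_gt_of_ne hk with hlt | hlt
      · exact hm.1 (A.mono (Fin.le_def.2 (by simpa using hlt)) hk'.2.2)
      · exact hk'.2.1 (A.mono (Fin.le_def.2 (by simpa using hlt)) hm.2)
    · simp
  · exact Finset.sum_eq_zero fun m _ => if_neg fun h' => h h'.1

/-- The `q - 1` nonzero vectors of a line give the same insertion, which cancels the division by `q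
- 1` in `vecWeight`. Summing over vectors avoids choosing representatives of lines. -/
theorem tsetlin_eq_sum [CharZero K] (x : Fin n → K) :
    tsetlin 𝔽 x = ∑ v : Fin n → 𝔽, vecWeight x v • insertMatrix K v := by
  rcases Nat.eq_zero_or_pos n with rfl | hn
  · simp [tsetlin, vecWeight]
  ext A B
  have hB := B.finrank_eq 1
  rw [val_one_of_pos (by omega)] at hB
  obtain ⟨u, hu0', hu'⟩ : ∃ u : Fin n → 𝔽, u ≠ 0 ∧ B.V 1 = span 𝔽 {u} := by
    obtain ⟨u, hu0, hu⟩ := finrank_eq_one_iff'.1 hB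
    refine ⟨u, by simpa using hu0, le_antisymm (fun w hw => ?_) (by simp)⟩
    obtain ⟨c, hc⟩ := hu ⟨w, hw⟩
    exact mem_span_singleton.2 ⟨c, congrArg Subtype.val hc⟩
  rw [tsetlin, weightOp, Matrix.mul_diagonal, sum_heckeWord_apply A B hu' hu0',
    flagWeight_eq x hu' hu0']
  simp only [Matrix.sum_apply, Matrix.smul_apply, insertMatrix, Matrix.of_apply, smul_eq_mul,
    mul_ite, mul_one, mul_zero, ite_mul, one_mul, zero_mul]
  have key : ∀ v : Fin n → 𝔽, v ≠ 0 → (B = CompleteFlag.insert v A ↔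
      B = CompleteFlag.insert u A ∧ v ∈ B.V 1) := by
    intro v hv
    constructor
    · intro h
      have h1 : B.V 1 = span 𝔽 {v} := by rw [h, insert_V_one hn hv]
      exact ⟨by nth_rw 1 [h]; exact insert_eq_insert_of_span_eq (h1.symm.trans hu') A,
        h1 ▸ mem_span_singleton_self v⟩
    · rintro ⟨h, hvB⟩
      rw [hu'] at hvB
      obtain ⟨c, rfl⟩ := mem_span_singleton.1 hvB
      have hc : c ≠ 0 := by rintro rfl; simp at hv
      conv_lhs => rw [h]
      exact insert_eq_insert_of_span_eq (span_singleton_smul_eq (IsUnit.mk0 _ hc) _).symm A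
  split_ifs with h
  · have hcard : ((Finset.univ.filter fun v : Fin n → 𝔽 => v ∈ B.V 1).erase 0).card =
        Fintype.card 𝔽 - 1 := by
      rw [Finset.card_erase_of_mem (by simp)]
      have := Module.card_eq_pow_finrank (K := 𝔽) (V := B.V 1)
      rw [hB, pow_one, Fintype.card_subtype] at this
      rw [this]
    have hterm : ∀ v : Fin n → 𝔽, (if B = CompleteFlag.insert v A then vecWeight x v else 0) =
        if v ∈ (Finset.univ.filter fun v : Fin n → 𝔽 => v ∈ B.V 1).erase 0 then
          vecWeight x u else 0 := by
      intro v
      rcases eq_or_ne v 0 with rfl | hv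
      · simp [vecWeight_zero]
      · by_cases hvB : v ∈ B.V 1
        · rw [if_pos ((key v hv).2 ⟨h, hvB⟩), if_pos (by simp [hv, hvB])]
          have h1 := insert_V_one hn hv A
          rw [← (key v hv).2 ⟨h, hvB⟩] at h1
          have h2 := (flagWeight_eq x h1 hv).symm.trans (flagWeight_eq x hu' hu0')
          refine mul_left_cancel₀ ?_ h2
          rw [sub_ne_zero]
          exact_mod_cast (Fintype.one_lt_card (α := 𝔽)).ne'
        · rw [if_neg fun h' => hvB ((key v hv).1 h').2, if_neg (by simp [hvB])]
    rw [Finset.sum_congr rfl fun v _ => hterm v, Finset.sum_ite_mem, Finset.univ_inter,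
      Finset.sum_const, hcard, nsmul_eq_mul, Nat.cast_sub Fintype.card_pos, Nat.cast_one]
  · symm
    refine Finset.sum_eq_zero fun v _ => ?_
    split_ifs with hv
    · rcases eq_or_ne v 0 with rfl | hv0
      · exact vecWeight_zero x
      · exact absurd ((key v hv0).1 hv).1 h
    · rfl

end Operator

end Words

/-! ### Diagonalizability from an annihilating product of distinct linear factors. -/

section Diagonalization

open Polynomial

theorem ker_aeval_prod_X_sub_C_le {K V : Type*} [Field K] [AddCommGroup V] [Module K V]
    (f : Module.End K V) (s : Finset K) :
    LinearMap.ker (aeval f (∏ μ ∈ s, (X - C μ))) ≤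
      Submodule.span K {v | ∃ μ : K, f v = μ • v} := by
  induction s using Finset.induction_on with
  | empty =>
    intro v hv
    have : v = 0 := by simpa using hv
    simp [this]
  | insert a s ha ih =>
    have hco : IsCoprime (X - C a) (∏ μ ∈ s, (X - C μ)) :=
      IsCoprime.prod_right fun μ hμ =>
        isCoprime_X_sub_C_of_isUnit_sub
          (IsUnit.mk0 _ (sub_ne_zero.2 fun h => ha (h ▸ hμ)))
    rw [Finset.prod_insert ha, ← sup_ker_aeval_eq_ker_aeval_mul_of_coprime f hco]
    refine sup_le (fun v hv => Submodule.subset_span ⟨a, ?_⟩) ih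
    simpa [sub_eq_zero] using hv

theorem isDiagonalizable_of_aeval_eq_zero {ι K : Type*} [Fintype ι] [Field K] (M : Matrix ι ι K)
    (s : Finset K) (h : aeval M (∏ μ ∈ s, (X - C μ)) = 0) : IsDiagonalizable M := by
  have h' : aeval (Matrix.toLinAlgEquiv' M) (∏ μ ∈ s, (X - C μ)) = 0 := by
    rw [aeval_algHom_apply, h, map_zero]
  have hspan : ⊤ ≤ Submodule.span K {v | ∃ μ : K, Matrix.toLinAlgEquiv' M v = μ • v} := by
    have := ker_aeval_prod_X_sub_C_le (Matrix.toLinAlgEquiv' M) s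
    rwa [h', LinearMap.ker_zero] at this
  let b₀ := Module.Basis.ofSpan hspan
  let b := b₀.reindex (b₀.indexEquiv (Pi.basisFun K ι))
  have hb : ∀ i, ∃ μ : K, Matrix.toLinAlgEquiv' M (b i) = μ • b i := fun i =>
    Module.Basis.ofSpan_subset hspan ⟨_, (Module.Basis.reindex_apply _ _ _).symm⟩
  choose d hd using hb
  refine ⟨(Pi.basisFun K ι).toMatrix b, d, ?_, ?_⟩
  · have := (Pi.basisFun K ι).invertibleToMatrix b
    exact isUnit_of_invertible _
  · ext i j
    have := congrFun (hd j) i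
    rw [Matrix.mul_diagonal]
    simpa [Matrix.mul_apply, Matrix.mulVec, dotProduct, Module.Basis.toMatrix_apply, mul_comm]
      using this

end Diagonalization

/-! ### The insertion walk and its annihilating polynomial. -/

section Walk

variable {𝔽 : Type*} [Field 𝔽] {n : ℕ} {K : Type*} [Field K]

open Submodule Module CompleteFlag

/-- The matrix of the map that inserts a word in front of a flag. -/
def wordMatrix (K : Type*) [Field K] (ℓ : List (Fin n → 𝔽)) :
    Matrix (CompleteFlag 𝔽 n) (CompleteFlag 𝔽 n) K :=
  Matrix.of fun A B => if B = insertWord ℓ A then 1 else 0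

theorem wordMatrix_nil : wordMatrix K ([] : List (Fin n → 𝔽)) = 1 := by
  ext A B
  simp [wordMatrix, insertWord, Matrix.one_apply, eq_comm]

theorem wordMatrix_append_singleton {v : Fin n → 𝔽} {ℓ : List (Fin n → 𝔽)}
    (hv : v ∈ wordSpan ℓ) : wordMatrix K (ℓ ++ [v]) = wordMatrix K ℓ := by
  ext A B
  simp only [wordMatrix, insertWord_append, Matrix.of_apply]
  rw [show insertWord [v] A = insert v A from rfl, insertWord_insert hv]

variable [Fintype 𝔽]

theorem insertMatrix_mul_wordMatrix (v : Fin n → 𝔽) (ℓ : List (Fin n → 𝔽)) :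
    insertMatrix K v * wordMatrix K ℓ = wordMatrix K (ℓ ++ [v]) := by
  ext A B
  simp only [insertMatrix, wordMatrix, Matrix.mul_apply, Matrix.of_apply, insertWord_append,
    ite_mul, one_mul, zero_mul, Finset.sum_ite_eq', Finset.mem_univ, if_true]
  rfl

/-- The operator that inserts a random vector in front of a flag. -/
def walk (w : (Fin n → 𝔽) → K) : Matrix (CompleteFlag 𝔽 n) (CompleteFlag 𝔽 n) K :=
  ∑ v, w v • insertMatrix K v

/-- The total weight of the vectors in a subspace. -/
def subspaceWeight (w : (Fin n → 𝔽) → K) (Y : Submodule 𝔽 (Fin n → 𝔽)) : K :=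
  ∑ v with v ∈ Y, w v

theorem walk_mul_wordMatrix (w : (Fin n → 𝔽) → K) (ℓ : List (Fin n → 𝔽)) :
    walk w * wordMatrix K ℓ = ∑ v, w v • wordMatrix K (ℓ ++ [v]) := by
  simp only [walk, Finset.sum_mul, Matrix.smul_mul, insertMatrix_mul_wordMatrix]

/-- Letters from the span are absorbed and contribute exactly the scalar that is subtracted, so only
letters enlarging the span survive. -/
theorem walk_mul_wordMatrix_sub (w : (Fin n → 𝔽) → K) (ℓ : List (Fin n → 𝔽)) :
    walk w * wordMatrix K ℓ - subspaceWeight w (wordSpan ℓ) • wordMatrix K ℓ =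
      ∑ v with v ∉ wordSpan ℓ, w v • wordMatrix K (ℓ ++ [v]) := by
  rw [walk_mul_wordMatrix, ← Finset.sum_filter_add_sum_filter_not _ (fun v => v ∈ wordSpan ℓ),
    subspaceWeight, Finset.sum_smul, Finset.sum_congr rfl fun v hv => by
      rw [wordMatrix_append_singleton (Finset.mem_filter.1 hv).2]]
  exact add_sub_cancel_left _ _

-- Induction on the codimension of the span. The factor for the current span is used up; by `hw` its
-- value cannot recur above a larger span reached by a letter of nonzero weight, so erasing it from
-- `s` is harmless.
open Polynomial in
theorem aeval_walk_mul_wordMatrix_eq_zero {w : (Fin n → 𝔽) → K}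
    (hw : ∀ X Y : Submodule 𝔽 (Fin n → 𝔽), X ≤ Y → subspaceWeight w X = subspaceWeight w Y →
      ∀ v ∈ Y, v ∉ X → w v = 0)
    (ℓ : List (Fin n → 𝔽)) (s : Finset K)
    (hs : ∀ Y, wordSpan ℓ ≤ Y → subspaceWeight w Y ∈ s) :
    aeval (walk w) (∏ μ ∈ s, (X - C μ)) * wordMatrix K ℓ = 0 := by
  induction hd : n - finrank 𝔽 (wordSpan ℓ) using Nat.strong_induction_on generalizing ℓ s with
  | _ d ih =>
    have key : aeval (walk w) (X - C (subspaceWeight w (wordSpan ℓ))) * wordMatrix K ℓ =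
        ∑ v with v ∉ wordSpan ℓ, w v • wordMatrix K (ℓ ++ [v]) := by
      rw [← walk_mul_wordMatrix_sub, map_sub, aeval_X, aeval_C, sub_mul,
        Algebra.algebraMap_eq_smul_one, Matrix.smul_mul, one_mul]
    rw [← Finset.prod_erase_mul s _ (hs _ le_rfl), map_mul, mul_assoc, key, Finset.mul_sum]
    refine Finset.sum_eq_zero fun v hv => ?_
    have hv := (Finset.mem_filter.1 hv).2
    by_cases hv0 : w v = 0
    · simp [hv0]
    · rw [Matrix.mul_smul, ih _ _ _ _ _ rfl, smul_zero]
      · rw [wordSpan_append_singleton, finrank_sup_span_singleton hv]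
        have := finrank_lt (fun h => hv (h ▸ mem_top) : wordSpan ℓ ≠ ⊤)
        rw [finrank_fin_fun] at this
        omega
      · intro Y hY
        rw [wordSpan_append_singleton, sup_le_iff, span_singleton_le_iff_mem] at hY
        exact Finset.mem_erase.2 ⟨fun h => hv0 (hw _ _ hY.1 h.symm v hY.2 hv), hs Y hY.1⟩

theorem isDiagonalizable_walk {w : (Fin n → 𝔽) → K}
    (hw : ∀ X Y : Submodule 𝔽 (Fin n → 𝔽), X ≤ Y → subspaceWeight w X = subspaceWeight w Y →
      ∀ v ∈ Y, v ∉ X → w v = 0) : IsDiagonalizable (walk w) := by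
  apply isDiagonalizable_of_aeval_eq_zero _ (Finset.univ.image (subspaceWeight w))
  have := aeval_walk_mul_wordMatrix_eq_zero hw [] (Finset.univ.image (subspaceWeight w))
    fun Y _ => Finset.mem_image_of_mem _ (Finset.mem_univ Y)
  rwa [wordMatrix_nil, mul_one] at this

end Walk

/-! ### Counting fixed flags and computing traces. -/

section Counting

variable {𝔽 : Type*} [Field 𝔽] [Fintype 𝔽] {n : ℕ}

open Submodule Module CompleteFlag

theorem card_filter_mem (Y : Submodule 𝔽 (Fin n → 𝔽)) :
    (Finset.univ.filter fun v : Fin n → 𝔽 => v ∈ Y).card = Fintype.card 𝔽 ^ finrank 𝔽 Y := by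
  rw [← Module.card_eq_pow_finrank (K := 𝔽) (V := Y), Fintype.card_subtype]

theorem card_filter_mem_notMem {X Y : Submodule 𝔽 (Fin n → 𝔽)} (h : X ≤ Y) :
    ((Finset.univ.filter fun v : Fin n → 𝔽 => v ∈ Y ∧ v ∉ X).card : ℚ) =
      (Fintype.card 𝔽 : ℚ) ^ finrank 𝔽 Y - (Fintype.card 𝔽 : ℚ) ^ finrank 𝔽 X := by
  have h1 := card_filter_mem Y
  have h2 := card_filter_mem X
  rw [← Finset.card_filter_add_card_filter_not (fun v => v ∈ X), Finset.filter_filter,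
    Finset.filter_filter] at h1
  have h3 : (Finset.univ.filter fun v : Fin n → 𝔽 => v ∈ Y ∧ v ∈ X) =
      Finset.univ.filter fun v : Fin n → 𝔽 => v ∈ X :=
    Finset.filter_congr fun v _ => ⟨fun h => h.2, fun h' => ⟨h h', h'⟩⟩
  rw [h3, h2] at h1
  rw [← Nat.cast_pow, ← h1]
  push_cast
  ring

theorem one_lt_card_rat : (1 : ℚ) < Fintype.card 𝔽 := by
  exact_mod_cast Fintype.one_lt_card (α := 𝔽)

/-- The number of flags that are fixed by inserting a word. -/
def fixCount (ℓ : List (Fin n → 𝔽)) : ℕ :=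
  (Finset.univ.filter fun A : CompleteFlag 𝔽 n => insertWord ℓ A = A).card

/-- Double count of pairs `(A, v)` with `A` fixed by the word and `v ∈ A_{k+1}` outside the span,
which is `A_k`. -/
theorem sum_fixCount_append (ℓ : List (Fin n → 𝔽)) (k : Fin n)
    (hk : finrank 𝔽 (wordSpan ℓ) = k) :
    ∑ v with v ∉ wordSpan ℓ, (fixCount (ℓ ++ [v]) : ℚ) =
      fixCount ℓ *
        ((Fintype.card 𝔽 : ℚ) ^ ((k : ℕ) + 1) - (Fintype.card 𝔽 : ℚ) ^ (k : ℕ)) := by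
  have h1 : ∀ v ∈ Finset.univ.filter fun v => v ∉ wordSpan ℓ, (fixCount (ℓ ++ [v]) : ℚ) =
      ∑ A with insertWord ℓ A = A, if v ∈ A.V k.succ then 1 else 0 := by
    intro v hv
    rw [fixCount, Finset.sum_boole, Finset.filter_filter]
    simp only [insertWord_append_singleton_eq_self (Finset.mem_filter.1 hv).2 hk]
  rw [Finset.sum_congr rfl h1, Finset.sum_comm, fixCount, ← nsmul_eq_mul]
  refine Finset.sum_eq_card_nsmul fun A hA => ?_
  have hA := (Finset.mem_filter.1 hA).2
  have hX := V_finrank_wordSpan (k := k.castSucc) hA (by simpa using hk)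
  have hle : wordSpan ℓ ≤ A.V k.succ := hX ▸ A.mono (Fin.castSucc_le_succ k)
  have := card_filter_mem_notMem hle
  rw [A.finrank_eq, hk, Fin.val_succ] at this
  rw [Finset.sum_boole, Finset.filter_filter, ← this]
  simp only [and_comm]

/-- Downward induction on the span. A spanning word sends all flags to a single one; otherwise all
one-letter extensions have the same count by induction, and the double count gives the factor
`[d+1]_q`. -/
theorem fixCount_eq (ℓ : List (Fin n → 𝔽)) :
    (fixCount ℓ : ℚ) = qFactorial (Fintype.card 𝔽) (n - finrank 𝔽 (wordSpan ℓ)) := by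
  induction hd : n - finrank 𝔽 (wordSpan ℓ) generalizing ℓ with
  | zero =>
    have hle := Submodule.finrank_le (wordSpan ℓ)
    rw [finrank_fin_fun] at hle
    have htop : wordSpan ℓ = ⊤ :=
      Submodule.eq_top_of_finrank_eq (by rw [finrank_fin_fun]; omega)
    have hconst : ∀ A B : CompleteFlag 𝔽 n, insertWord ℓ A = insertWord ℓ B := fun A B => by
      apply ext_range
      rw [range_insertWord, range_insertWord]
      simp [htop]
    rw [qFactorial_zero, fixCount, Nat.cast_eq_one, Finset.card_eq_one]
    obtain ⟨A⟩ := (inferInstance : Nonempty (CompleteFlag 𝔽 n))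
    refine ⟨insertWord ℓ A, ?_⟩
    ext B
    simp only [Finset.mem_filter, Finset.mem_univ, true_and, Finset.mem_singleton]
    exact ⟨fun h => h.symm.trans (hconst B A), fun h => by rw [h, insertWord_self]⟩
  | succ d ih =>
    have hk : finrank 𝔽 (wordSpan ℓ) < n := by omega
    have h1 := sum_fixCount_append ℓ ⟨_, hk⟩ rfl
    have h2 : ∀ v ∈ Finset.univ.filter fun v => v ∉ wordSpan ℓ, (fixCount (ℓ ++ [v]) : ℚ) =
        qFactorial (Fintype.card 𝔽) d := fun v hv => by
      apply ih
      rw [wordSpan_append_singleton, finrank_sup_span_singleton (Finset.mem_filter.1 hv).2]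
      omega
    have h3 := card_filter_mem_notMem (le_top : wordSpan ℓ ≤ ⊤)
    simp only [mem_top, true_and, finrank_top, finrank_fin_fun] at h3
    have hn : n = finrank 𝔽 (wordSpan ℓ) + (d + 1) := by omega
    rw [Finset.sum_eq_card_nsmul h2, nsmul_eq_mul, h3] at h1
    simp only at h1
    nth_rw 1 [hn] at h1
    rw [pow_sub_pow_eq_mul_qInt, pow_sub_pow_eq_mul_qInt] at h1
    have hq := one_lt_card_rat (𝔽 := 𝔽)
    have hq1 : (Fintype.card 𝔽 : ℚ) - 1 ≠ 0 := by linarith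
    have hq0 : (Fintype.card 𝔽 : ℚ) ^ finrank 𝔽 (wordSpan ℓ) ≠ 0 := by positivity
    have h4 : qInt (Fintype.card 𝔽) 1 = 1 := by simp [qInt]
    rw [qFactorial_succ]
    apply mul_left_cancel₀ (mul_ne_zero hq0 hq1)
    rw [h4] at h1
    linear_combination -h1

/-- The number of `r`-dimensional subspaces that contain `X`. -/
def overCount (X : Submodule 𝔽 (Fin n → 𝔽)) (r : ℕ) : ℕ :=
  (Finset.univ.filter fun Y : Submodule 𝔽 (Fin n → 𝔽) => X ≤ Y ∧ finrank 𝔽 Y = r).card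

theorem sum_overCount_sup (X : Submodule 𝔽 (Fin n → 𝔽)) (r : ℕ) :
    ∑ v with v ∉ X, (overCount (X ⊔ span 𝔽 {v}) r : ℚ) =
      overCount X r *
        ((Fintype.card 𝔽 : ℚ) ^ r - (Fintype.card 𝔽 : ℚ) ^ finrank 𝔽 X) := by
  have h1 : ∀ v : Fin n → 𝔽, (overCount (X ⊔ span 𝔽 {v}) r : ℚ) =
      ∑ Y with X ≤ Y ∧ finrank 𝔽 Y = r, if v ∈ Y then 1 else 0 := by
    intro v
    rw [overCount, Finset.sum_boole, Finset.filter_filter]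
    simp only [sup_le_iff, span_singleton_le_iff_mem, and_right_comm]
  simp only [h1]
  rw [Finset.sum_comm, overCount, ← nsmul_eq_mul]
  refine Finset.sum_eq_card_nsmul fun Y hY => ?_
  obtain ⟨hXY, hr⟩ := (Finset.mem_filter.1 hY).2
  have := card_filter_mem_notMem hXY
  rw [hr] at this
  rw [Finset.sum_boole, Finset.filter_filter, ← this]
  simp only [and_comm]

/-- A Gaussian binomial coefficient, obtained by double counting pairs of a subspace over `X` and a
vector of it outside `X`. -/
theorem overCount_eq (X : Submodule 𝔽 (Fin n → 𝔽)) {j i : ℕ}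
    (h : finrank 𝔽 X + j + i = n) :
    (overCount X (finrank 𝔽 X + j) : ℚ) = qFactorial (Fintype.card 𝔽) (j + i) /
      (qFactorial (Fintype.card 𝔽) j * qFactorial (Fintype.card 𝔽) i) := by
  induction j generalizing X with
  | zero =>
    have hi := (qFactorial_pos (Fintype.card 𝔽) i).ne'
    rw [qFactorial_zero, Nat.zero_add, one_mul, div_self hi, Nat.cast_eq_one, overCount,
      Finset.card_eq_one]
    refine ⟨X, ?_⟩
    ext Y
    simp only [Finset.mem_filter, Finset.mem_univ, true_and, Finset.mem_singleton]
    constructor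
    · rintro ⟨h, h'⟩
      exact (Submodule.eq_of_le_of_finrank_eq h h'.symm).symm
    · rintro rfl
      simp
  | succ j ih =>
    have h1 := sum_overCount_sup X (finrank 𝔽 X + (j + 1))
    have h2 : ∀ v ∈ Finset.univ.filter fun v => v ∉ X,
        (overCount (X ⊔ span 𝔽 {v}) (finrank 𝔽 X + (j + 1)) : ℚ) =
        qFactorial (Fintype.card 𝔽) (j + i) /
          (qFactorial (Fintype.card 𝔽) j * qFactorial (Fintype.card 𝔽) i) := fun v hv => by
      have hr := finrank_sup_span_singleton (Finset.mem_filter.1 hv).2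
      rw [← ih (X ⊔ span 𝔽 {v}) (by omega), hr]
      congr 2
      omega
    have h3 := card_filter_mem_notMem (le_top : X ≤ ⊤)
    simp only [mem_top, true_and, finrank_top, finrank_fin_fun] at h3
    have hn : n = finrank 𝔽 X + (j + i + 1) := by omega
    rw [Finset.sum_eq_card_nsmul h2, nsmul_eq_mul, h3] at h1
    nth_rw 1 [hn] at h1
    rw [pow_sub_pow_eq_mul_qInt, pow_sub_pow_eq_mul_qInt] at h1
    have hq := one_lt_card_rat (𝔽 := 𝔽)
    have hq1 : (Fintype.card 𝔽 : ℚ) - 1 ≠ 0 := by linarith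
    have hq0 : (Fintype.card 𝔽 : ℚ) ^ finrank 𝔽 X ≠ 0 := by positivity
    have hj := (qInt_succ_pos (Fintype.card 𝔽) j).ne'
    have hj' := (qFactorial_pos (Fintype.card 𝔽) j).ne'
    have hi := (qFactorial_pos (Fintype.card 𝔽) i).ne'
    rw [show j + 1 + i = j + i + 1 by omega, qFactorial_succ, qFactorial_succ]
    apply mul_right_cancel₀ (mul_ne_zero (mul_ne_zero hq0 hq1) hj)
    rw [← h1]
    field_simp

theorem sum_natDerangement (X : Submodule 𝔽 (Fin n → 𝔽)) :
    ((∑ Y with X ≤ Y, natDerangement (Fintype.card 𝔽) (n - finrank 𝔽 Y) : ℕ) : ℚ) =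
      qFactorial (Fintype.card 𝔽) (n - finrank 𝔽 X) := by
  have hX := Submodule.finrank_le X
  rw [finrank_fin_fun] at hX
  push_cast
  simp only [natDerangement_cast]
  have hmaps : ∀ Y ∈ Finset.univ.filter fun Y : Submodule 𝔽 (Fin n → 𝔽) => X ≤ Y,
      finrank 𝔽 Y - finrank 𝔽 X ∈ Finset.range (n - finrank 𝔽 X + 1) := fun Y _ => by
    have hY := Submodule.finrank_le Y
    rw [finrank_fin_fun] at hY
    rw [Finset.mem_range]
    omega
  rw [← Finset.sum_fiberwise_of_maps_to hmaps, ← mul_one (qFactorial _ _),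
    ← sum_qDerangement_div (Fintype.card 𝔽) (n - finrank 𝔽 X), Finset.mul_sum]
  refine Finset.sum_congr rfl fun j hj => ?_
  rw [Finset.mem_range] at hj
  have hset : (Finset.univ.filter fun Y : Submodule 𝔽 (Fin n → 𝔽) => X ≤ Y).filter
      (fun Y : Submodule 𝔽 (Fin n → 𝔽) => finrank 𝔽 Y - finrank 𝔽 X = j) =
      Finset.univ.filter fun Y : Submodule 𝔽 (Fin n → 𝔽) => X ≤ Y ∧ finrank 𝔽 Y = finrank 𝔽 X + j := by
    rw [Finset.filter_filter]
    refine Finset.filter_congr fun Y _ => and_congr_right fun h => ?_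
    have := Submodule.finrank_mono h
    omega
  have hcount := overCount_eq X (j := j) (i := n - finrank 𝔽 X - j) (by omega)
  rw [overCount, show j + (n - finrank 𝔽 X - j) = n - finrank 𝔽 X by omega] at hcount
  rw [hset, Finset.sum_eq_card_nsmul (b := qDerangement (Fintype.card 𝔽) (n - finrank 𝔽 X - j)),
    nsmul_eq_mul, hcount]
  · ring
  · intro Y hY
    rw [(Finset.mem_filter.1 hY).2.2, Nat.sub_add_eq]

theorem fixCount_eq_sum (ℓ : List (Fin n → 𝔽)) :
    fixCount ℓ = ∑ Y with wordSpan ℓ ≤ Y,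
      natDerangement (Fintype.card 𝔽) (n - finrank 𝔽 Y) := by
  have : (fixCount ℓ : ℚ) = _ := (fixCount_eq ℓ).trans (sum_natDerangement _).symm
  exact_mod_cast this

theorem trace_wordMatrix {K : Type*} [Field K] (ℓ : List (Fin n → 𝔽)) :
    (wordMatrix K ℓ).trace = fixCount ℓ := by
  simp [Matrix.trace, wordMatrix, fixCount, eq_comm]

/-- Peeling off one insertion appends a letter `v` and restricts to the `Y` containing `v`; summing
over `v` produces one more factor `w(Y)`. The induction needs arbitrary words, although only the
empty one is used later. -/
theorem trace_walk_pow_mul_wordMatrix {K : Type*} [Field K] (w : (Fin n → 𝔽) → K) (t : ℕ)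
    (ℓ : List (Fin n → 𝔽)) :
    (walk w ^ t * wordMatrix K ℓ).trace = ∑ Y with wordSpan ℓ ≤ Y,
      (natDerangement (Fintype.card 𝔽) (n - finrank 𝔽 Y) : K) * subspaceWeight w Y ^ t := by
  induction t generalizing ℓ with
  | zero => simp [trace_wordMatrix, fixCount_eq_sum]
  | succ t ih =>
    rw [pow_succ, mul_assoc, walk_mul_wordMatrix, Finset.mul_sum, Matrix.trace_sum]
    simp only [Matrix.mul_smul, Matrix.trace_smul, ih, wordSpan_append_singleton, sup_le_iff,
      span_singleton_le_iff_mem, smul_eq_mul, Finset.mul_sum]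
    have h : ∀ v : Fin n → 𝔽,
        (Finset.univ.filter fun Y : Submodule 𝔽 (Fin n → 𝔽) => wordSpan ℓ ≤ Y ∧ v ∈ Y) =
          (Finset.univ.filter fun Y => wordSpan ℓ ≤ Y).filter fun Y => v ∈ Y :=
      fun v => (Finset.filter_filter _ _ _).symm
    simp only [h, Finset.sum_filter (fun Y : Submodule 𝔽 (Fin n → 𝔽) => _ ∈ Y)]
    rw [Finset.sum_comm]
    refine Finset.sum_congr rfl fun Y _ => ?_
    rw [pow_succ, subspaceWeight, ← Finset.sum_filter, ← mul_assoc, Finset.mul_sum]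
    exact Finset.sum_congr rfl fun v _ => mul_comm _ _

theorem trace_walk_pow {K : Type*} [Field K] (w : (Fin n → 𝔽) → K) (t : ℕ) :
    (walk w ^ t).trace = ∑ Y : Submodule 𝔽 (Fin n → 𝔽),
      (natDerangement (Fintype.card 𝔽) (n - finrank 𝔽 Y) : K) * subspaceWeight w Y ^ t := by
  have := trace_walk_pow_mul_wordMatrix w t []
  simpa [wordMatrix_nil, wordSpan_nil] using this

end Counting

/-! ### Traces of powers determine the characteristic polynomial. -/

section PowerSums

open Polynomial Module.End

/-- On a generalized eigenspace `f - μ` is nilpotent and commutes with `f ^ t`, so each further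
factor `f` multiplies the trace by `μ`. -/
theorem trace_restrict_maxGenEigenspace_pow {K V : Type*} [Field K] [AddCommGroup V] [Module K V]
    [FiniteDimensional K V] (f : Module.End K V) (μ : K) (t : ℕ)
    (h : Set.MapsTo (f ^ t) (f.maxGenEigenspace μ) (f.maxGenEigenspace μ)) :
    LinearMap.trace K _ ((f ^ t).restrict h) =
      Module.finrank K (f.maxGenEigenspace μ) * μ ^ t := by
  have hf := f.mapsTo_maxGenEigenspace_of_comm (Commute.refl f) μ
  have key : ∀ t : ℕ, LinearMap.trace K _ ((f.restrict hf) ^ t) =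
      Module.finrank K (f.maxGenEigenspace μ) * μ ^ t := by
    intro t
    induction t with
    | zero => simp
    | succ t ih =>
      rw [pow_succ, Module.End.mul_eq_comp, LinearMap.trace_comp_eq_mul_of_commute_of_isNilpotent μ
        (Commute.pow_left (Commute.refl _) t)
        (f.isNilpotent_restrict_maxGenEigenspace_sub_algebraMap μ), ih]
      ring
  rw [← key t]
  congr 1
  exact (Module.End.pow_restrict t hf h).symm

theorem trace_pow_eq_sum_rootMultiplicity {K V : Type*} [Field K] [IsAlgClosed K]
    [AddCommGroup V] [Module K V] [FiniteDimensional K V] (f : Module.End K V) (t : ℕ)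
    (s : Finset K) (hs : ∀ μ, f.charpoly.rootMultiplicity μ ≠ 0 → μ ∈ s) :
    LinearMap.trace K V (f ^ t) = ∑ μ ∈ s, (f.charpoly.rootMultiplicity μ : K) * μ ^ t := by
  have hmaps : ∀ μ, Set.MapsTo (f ^ t) (f.maxGenEigenspace μ) (f.maxGenEigenspace μ) := fun μ =>
    f.mapsTo_maxGenEigenspace_of_comm (Commute.pow_right (Commute.refl f) t) μ
  have hint : DirectSum.IsInternal fun μ => f.maxGenEigenspace μ :=
    DirectSum.isInternal_submodule_of_iSupIndep_of_iSup_eq_top f.independent_maxGenEigenspace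
      (iSup_maxGenEigenspace_eq_top f)
  have hfin := WellFoundedGT.finite_ne_bot_of_iSupIndep f.independent_maxGenEigenspace
  rw [LinearMap.trace_eq_sum_trace_restrict' hint hfin hmaps]
  simp only [trace_restrict_maxGenEigenspace_pow, LinearMap.finrank_maxGenEigenspace_eq]
  refine Finset.sum_subset (fun μ hμ => hs μ ?_) fun μ _ hμ => ?_
  · rw [← LinearMap.finrank_maxGenEigenspace_eq]
    intro h
    simp only [Set.Finite.mem_toFinset, Set.mem_ofPred_eq] at hμ
    exact hμ (Submodule.finrank_eq_zero.1 h)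
  · simp only [Set.Finite.mem_toFinset, Set.mem_ofPred_eq, not_not] at hμ
    rw [← LinearMap.finrank_maxGenEigenspace_eq, hμ]
    simp

/-- By linearity the identity holds with any polynomial in place of powers; one vanishing on `s`
except at `μ` isolates the coefficient. -/
theorem eq_of_forall_sum_mul_pow_eq {K : Type*} [Field K] [CharZero K] {s : Finset K}
    {a b : K → ℕ} (h : ∀ t : ℕ, ∑ μ ∈ s, (a μ : K) * μ ^ t = ∑ μ ∈ s, (b μ : K) * μ ^ t)
    {μ : K} (hμ : μ ∈ s) : a μ = b μ := by
  have hp (p : K[X]) : ∑ μ ∈ s, (a μ : K) * p.eval μ = ∑ μ ∈ s, (b μ : K) * p.eval μ := by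
    simp only [eval_eq_sum_range, Finset.mul_sum]
    rw [Finset.sum_comm, Finset.sum_comm (s := s)]
    refine Finset.sum_congr rfl fun t _ => ?_
    simp only [mul_left_comm _ (p.coeff t), ← Finset.mul_sum, h]
  have hμ' := hp (∏ ν ∈ s.erase μ, (X - C ν))
  have hz : ∀ c : K → ℕ, ∑ ξ ∈ s, (c ξ : K) * (∏ ν ∈ s.erase μ, (X - C ν)).eval ξ =
      c μ * (∏ ν ∈ s.erase μ, (X - C ν)).eval μ := fun c =>
    Finset.sum_eq_single_of_mem μ hμ fun ξ hξ hne => by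
      rw [eval_prod, Finset.prod_eq_zero (Finset.mem_erase.2 ⟨hne, hξ⟩) (by simp), mul_zero]
  rw [hz, hz] at hμ'
  have hne : (∏ ν ∈ s.erase μ, (X - C ν)).eval μ ≠ 0 := by
    rw [eval_prod]
    refine Finset.prod_ne_zero_iff.2 fun ν hν => ?_
    simpa [sub_eq_zero] using (Finset.ne_of_mem_erase hν).symm
  exact_mod_cast mul_right_cancel₀ hne hμ'

theorem charpoly_eq_of_trace_pow_of_isAlgClosed {ι κ K : Type*} [Fintype ι] [DecidableEq ι]
    [Fintype κ] [Field K] [CharZero K] [IsAlgClosed K] (M : Matrix ι ι K) (c : κ → ℕ) (l : κ → K)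
    (h : ∀ t : ℕ, (M ^ t).trace = ∑ i, (c i : K) * l i ^ t) :
    M.charpoly = ∏ i, (X - C (l i)) ^ c i := by
  have hP : (∏ i, (X - C (l i)) ^ c i).Monic :=
    monic_prod_of_monic _ _ fun i _ => (monic_X_sub_C _).pow _
  have hsplit : (∏ i, (X - C (l i)) ^ c i).Splits := IsAlgClosed.splits _
  have hsplit' : M.charpoly.Splits := IsAlgClosed.splits _
  rw [hsplit'.eq_prod_roots_of_monic (M.charpoly_monic), hsplit.eq_prod_roots_of_monic hP]
  congr 2
  ext μ
  rw [count_roots, count_roots]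
  let s : Finset K := Insert.insert μ (M.charpoly.roots.toFinset ∪ Finset.univ.image l)
  have hroot : ∀ ν, (∏ i, (X - C (l i)) ^ c i).rootMultiplicity ν =
      ∑ i with l i = ν, c i := fun ν => by
    rw [← count_roots, roots_prod _ _ (hP.ne_zero), Multiset.count_bind]
    simp [Multiset.count_singleton, Finset.sum_filter, eq_comm]
  refine eq_of_forall_sum_mul_pow_eq (s := s) (a := fun ν => M.charpoly.rootMultiplicity ν)
    (b := fun ν => (∏ i, (X - C (l i)) ^ c i).rootMultiplicity ν) (fun t => ?_)
    (Finset.mem_insert_self _ _)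
  have h1 := trace_pow_eq_sum_rootMultiplicity (Matrix.toLin' M) t s fun ν hν => by
    simp only [s, Finset.mem_insert, Finset.mem_union, Multiset.mem_toFinset]
    refine Or.inr (Or.inl ?_)
    rw [← Multiset.count_ne_zero, count_roots]
    simpa using hν
  rw [← Matrix.toLin'_pow, Matrix.trace_toLin'_eq, h t] at h1
  simp only [Matrix.charpoly_toLin'] at h1
  rw [← h1]
  simp only [hroot]
  rw [← Finset.sum_fiberwise_of_maps_to (s := Finset.univ) (t := s) (g := l)
    (fun i _ => by simp [s])]
  refine Finset.sum_congr rfl fun ν _ => ?_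
  rw [Nat.cast_sum, Finset.sum_mul]
  exact Finset.sum_congr rfl fun i hi => by rw [(Finset.mem_filter.1 hi).2]

theorem charpoly_eq_of_trace_pow {ι κ K : Type*} [Fintype ι] [DecidableEq ι]
    [Fintype κ] [Field K] [CharZero K] (M : Matrix ι ι K) (c : κ → ℕ) (l : κ → K)
    (h : ∀ t : ℕ, (M ^ t).trace = ∑ i, (c i : K) * l i ^ t) :
    M.charpoly = ∏ i, (X - C (l i)) ^ c i := by
  let φ := algebraMap K (AlgebraicClosure K)
  have : CharZero (AlgebraicClosure K) := charZero_of_injective_algebraMap φ.injective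
  apply Polynomial.map_injective φ φ.injective
  rw [← Matrix.charpoly_map, charpoly_eq_of_trace_pow_of_isAlgClosed (M.map φ) c fun i => φ (l i)]
  · simp [Polynomial.map_prod]
  · intro t
    have := congrArg φ (h t)
    rw [← Matrix.map_pow, ← AddMonoidHom.map_trace] 
    simpa using this

end PowerSums

/-! ### Subspaces grouped by pivots. -/

section Pivots

variable {𝔽 : Type*} [Field 𝔽] {n : ℕ}

open Submodule Module

/-- The vectors whose entries before position `i` vanish. -/
def tail (𝔽 : Type*) [Field 𝔽] (n i : ℕ) : Submodule 𝔽 (Fin n → 𝔽) where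
  carrier := {v | ∀ k : Fin n, (k : ℕ) < i → v k = 0}
  add_mem' hv hw k hk := by simp [hv k hk, hw k hk]
  zero_mem' _ _ := rfl
  smul_mem' c v hv k hk := by simp [hv k hk]

theorem tail_antitone : Antitone (tail 𝔽 n) := fun _ _ h _ hv k hk => hv k (hk.trans_le h)

theorem tail_zero : tail 𝔽 n 0 = ⊤ := eq_top_iff.2 fun _ _ _ hk => absurd hk (by omega)

theorem tail_self : tail 𝔽 n n = ⊥ :=
  eq_bot_iff.2 fun _ hv => (mem_bot 𝔽).2 (funext fun k => hv k k.2)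

theorem leads_iff {v : Fin n → 𝔽} {i : Fin n} :
    Leads v i ↔ v ∈ tail 𝔽 n i ∧ v ∉ tail 𝔽 n (i + 1) := by
  constructor
  · rintro ⟨h, h'⟩
    exact ⟨fun k hk => h' k hk, fun hv => h (hv i (Nat.lt_succ_self _))⟩
  · rintro ⟨h, h'⟩
    have h2 : ∀ k < i, v k = 0 := fun k hk => h k hk
    refine ⟨fun h0 => h' fun k hk => ?_, h2⟩
    rcases Nat.lt_succ_iff_lt_or_eq.1 hk with hk | hk
    · exact h2 k hk
    · rwa [Fin.ext hk]

/-- The positions of the first nonzero entries of the vectors of a subspace. -/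
def pivots (Y : Submodule 𝔽 (Fin n → 𝔽)) : Finset (Fin n) :=
  Finset.univ.filter fun i => ∃ v ∈ Y, Leads v i

theorem mem_pivots {Y : Submodule 𝔽 (Fin n → 𝔽)} {i : Fin n} :
    i ∈ pivots Y ↔ ∃ v ∈ Y, Leads v i := by simp [pivots]

theorem exists_leads {v : Fin n → 𝔽} (hv : v ≠ 0) : ∃ i, Leads v i := by
  obtain ⟨k, hk⟩ := Function.ne_iff.1 hv
  have hne : (Finset.univ.filter fun k => v k ≠ 0).Nonempty := ⟨k, by simpa using hk⟩
  refine ⟨(Finset.univ.filter fun k => v k ≠ 0).min' hne, ?_, fun l hl => ?_⟩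
  · exact (Finset.mem_filter.1 (Finset.min'_mem _ hne)).2
  · by_contra h
    exact absurd (Finset.min'_le _ l (by simpa using h)) (not_le.2 hl)

theorem inf_tail_eq_sup {Y : Submodule 𝔽 (Fin n → 𝔽)} {a : Fin n} {v : Fin n → 𝔽} (hv : v ∈ Y)
    (hva : Leads v a) : Y ⊓ tail 𝔽 n a = (Y ⊓ tail 𝔽 n (a + 1)) ⊔ span 𝔽 {v} := by
  apply le_antisymm
  · rintro w ⟨hw, hwa⟩
    rw [mem_sup]
    have hmem : w - (w a / v a) • v ∈ Y ⊓ tail 𝔽 n (a + 1) := by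
      refine ⟨sub_mem hw (smul_mem _ _ hv), fun k hk => ?_⟩
      rcases Nat.lt_succ_iff_lt_or_eq.1 hk with hk | hk
      · simp [hwa k hk, hva.2 k hk]
      · rw [Fin.ext hk]
        simp [div_mul_cancel₀ _ hva.1]
    exact ⟨_, hmem, _, smul_mem _ (w a / v a) (mem_span_singleton_self v), by simp⟩
  · refine sup_le (inf_le_inf_left _ (tail_antitone (Nat.le_succ _))) ?_
    rw [span_singleton_le_iff_mem]
    exact ⟨hv, (leads_iff.1 hva).1⟩

/-- As `i` decreases, the dimension of the intersection grows by one exactly when `i` passes a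
pivot. -/
theorem finrank_inf_tail (Y : Submodule 𝔽 (Fin n → 𝔽)) {i : ℕ} (hi : i ≤ n) :
    finrank 𝔽 (Y ⊓ tail 𝔽 n i : Submodule 𝔽 (Fin n → 𝔽)) =
      ((pivots Y).filter fun s : Fin n => i ≤ s).card := by
  induction hd : n - i generalizing i with
  | zero =>
    obtain rfl : i = n := by omega
    rw [tail_self, inf_bot_eq, finrank_bot, eq_comm, Finset.card_eq_zero,
      Finset.filter_eq_empty_iff]
    intro s _
    have := s.2
    omega
  | succ d ih =>
    have ih := ih (i := i + 1) (by omega) (by omega)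
    obtain ⟨a, rfl⟩ : ∃ a : Fin n, (a : ℕ) = i := ⟨⟨i, by omega⟩, rfl⟩
    by_cases ha : a ∈ pivots Y
    · obtain ⟨v, hv, hva⟩ := mem_pivots.1 ha
      rw [inf_tail_eq_sup hv hva, finrank_sup_span_singleton (p := Y ⊓ tail 𝔽 n (a + 1))
        fun h => (leads_iff.1 hva).2 h.2, ih]
      have : (pivots Y).filter (fun s : Fin n => (a : ℕ) ≤ s) =
          Insert.insert a ((pivots Y).filter fun s : Fin n => (a : ℕ) + 1 ≤ s) := by
        ext s
        simp only [Finset.mem_filter, Finset.mem_insert]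
        constructor
        · rintro ⟨h, h'⟩
          rcases eq_or_lt_of_le h' with h' | h'
          · exact Or.inl (Fin.ext h'.symm)
          · exact Or.inr ⟨h, h'⟩
        · rintro (rfl | ⟨h, h'⟩)
          · exact ⟨ha, le_rfl⟩
          · exact ⟨h, by omega⟩
      rw [this, Finset.card_insert_of_notMem (by simp)]
    · have h1 : Y ⊓ tail 𝔽 n a = Y ⊓ tail 𝔽 n (a + 1) := by
        refine le_antisymm (fun w hw => ⟨hw.1, ?_⟩)
          (inf_le_inf_left _ (tail_antitone (Nat.le_succ _)))
        by_contra h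
        exact ha (mem_pivots.2 ⟨w, hw.1, leads_iff.2 ⟨hw.2, h⟩⟩)
      rw [h1, ih]
      congr 1
      refine Finset.filter_congr fun s hs => ⟨fun h => by omega, fun h => ?_⟩
      rcases eq_or_lt_of_le h with h | h
      · exact absurd ((Fin.ext h : a = s) ▸ hs) ha
      · exact h

theorem finrank_eq_card_pivots (Y : Submodule 𝔽 (Fin n → 𝔽)) :
    finrank 𝔽 Y = (pivots Y).card := by
  have := finrank_inf_tail Y (Nat.zero_le n)
  rw [tail_zero, inf_top_eq] at this
  simpa using this

theorem pivots_top : pivots (⊤ : Submodule 𝔽 (Fin n → 𝔽)) = Finset.univ := by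
  refine Finset.eq_univ_of_card _ ?_
  rw [← finrank_eq_card_pivots, finrank_top, finrank_fin_fun, Fintype.card_fin]

theorem le_tail_of_lt_pivots {Y : Submodule 𝔽 (Fin n → 𝔽)} {a : ℕ}
    (h : ∀ i ∈ pivots Y, a ≤ (i : ℕ)) : Y ≤ tail 𝔽 n a := by
  intro v hv
  rcases eq_or_ne v 0 with rfl | hv0
  · exact zero_mem _
  · obtain ⟨i, hi⟩ := exists_leads hv0
    exact tail_antitone (h i (mem_pivots.2 ⟨v, hv, hi⟩)) (leads_iff.1 hi).1

theorem pivots_inf_tail (Y : Submodule 𝔽 (Fin n → 𝔽)) (a : ℕ) :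
    pivots (Y ⊓ tail 𝔽 n a) = (pivots Y).filter fun i : Fin n => a ≤ (i : ℕ) := by
  ext i
  simp only [mem_pivots, Finset.mem_filter]
  constructor
  · rintro ⟨v, ⟨hv, hva⟩, hvi⟩
    exact ⟨⟨v, hv, hvi⟩, not_lt.1 fun h => hvi.1 (hva i h)⟩
  · rintro ⟨⟨v, hv, hvi⟩, hi⟩
    exact ⟨v, ⟨hv, tail_antitone hi (leads_iff.1 hvi).1⟩, hvi⟩

theorem sup_span_inf_tail {Y : Submodule 𝔽 (Fin n → 𝔽)} {a : Fin n} {v : Fin n → 𝔽}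
    (hY : Y ≤ tail 𝔽 n (a + 1)) (hv : Leads v a) :
    (Y ⊔ span 𝔽 {v}) ⊓ tail 𝔽 n (a + 1) = Y := by
  rw [sup_inf_assoc_of_le _ hY, inf_comm, disjoint_iff.1, sup_bot_eq]
  exact disjoint_span_singleton_of_notMem (leads_iff.1 hv).2

theorem pivots_sup_span {Y : Submodule 𝔽 (Fin n → 𝔽)} {a : Fin n} {v : Fin n → 𝔽}
    (hY : Y ≤ tail 𝔽 n (a + 1)) (hv : Leads v a) :
    pivots (Y ⊔ span 𝔽 {v}) = Insert.insert a (pivots Y) := by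
  have hle : Y ⊔ span 𝔽 {v} ≤ tail 𝔽 n a :=
    sup_le (hY.trans (tail_antitone (Nat.le_succ _))) (by simpa using (leads_iff.1 hv).1)
  have h1 := pivots_inf_tail (Y ⊔ span 𝔽 {v}) (a + 1)
  rw [sup_span_inf_tail hY hv] at h1
  ext i
  rw [h1, Finset.mem_insert, Finset.mem_filter]
  constructor
  · intro hi
    obtain ⟨w, hw, hwi⟩ := mem_pivots.1 hi
    have : (a : ℕ) ≤ i := not_lt.1 fun h => hwi.1 (hle hw i h)
    rcases eq_or_lt_of_le this with h | h
    · exact Or.inl (Fin.ext h.symm)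
    · exact Or.inr ⟨hi, h⟩
  · rintro (rfl | ⟨hi, -⟩)
    · exact mem_pivots.2 ⟨v, mem_sup_right (mem_span_singleton_self v), hv⟩
    · exact hi

variable [Fintype 𝔽]

/-- These vectors form the difference of two consecutive subspaces `Y ⊓ tail`, of dimensions
`position` and `position - 1`. -/
theorem card_leads {Y : Submodule 𝔽 (Fin n → 𝔽)} {i : Fin n} (hi : i ∈ pivots Y) :
    ((Finset.univ.filter fun v : Fin n → 𝔽 => v ∈ Y ∧ Leads v i).card : ℚ) =
      (Fintype.card 𝔽 : ℚ) ^ (position (pivots Y) i - 1) * ((Fintype.card 𝔽 : ℚ) - 1) := by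
  obtain ⟨v, hv, hvi⟩ := mem_pivots.1 hi
  have h1 : finrank 𝔽 (Y ⊓ tail 𝔽 n i : Submodule 𝔽 (Fin n → 𝔽)) = position (pivots Y) i :=
    finrank_inf_tail Y i.2.le
  have h2 := inf_tail_eq_sup hv hvi
  have h3 := finrank_sup_span_singleton (p := Y ⊓ tail 𝔽 n (i + 1)) (v := v)
    fun h => (leads_iff.1 hvi).2 h.2
  rw [← h2, h1] at h3
  have h4 := card_filter_mem_notMem
    (inf_le_inf_left Y (tail_antitone (𝔽 := 𝔽) (n := n) (Nat.le_succ i)))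
  have h5 : (Finset.univ.filter fun v : Fin n → 𝔽 => v ∈ Y ∧ Leads v i) =
      Finset.univ.filter fun v => v ∈ Y ⊓ tail 𝔽 n i ∧ v ∉ Y ⊓ tail 𝔽 n (Nat.succ i) := by
    refine Finset.filter_congr fun v _ => ?_
    rw [leads_iff, mem_inf, mem_inf]
    tauto
  rw [h5, h4, h1, h3, Nat.add_sub_cancel, pow_succ]
  ring

theorem position_le {S : Finset (Fin n)} (i : Fin n) : position S i + i ≤ n := by
  have : position S i ≤ (Finset.Ici i).card :=
    Finset.card_le_card fun t ht => Finset.mem_Ici.2 (Finset.mem_filter.1 ht).2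
  rw [Fin.card_Ici] at this
  have := i.2
  omega

theorem position_pos {S : Finset (Fin n)} {i : Fin n} (hi : i ∈ S) : 0 < position S i :=
  Finset.card_pos.2 ⟨i, Finset.mem_filter.2 ⟨hi, le_rfl⟩⟩

theorem subspaceWeight_vecWeight {K : Type*} [Field K] [CharZero K] (x : Fin n → K)
    (Y : Submodule 𝔽 (Fin n → 𝔽)) :
    subspaceWeight (vecWeight x) Y = eigenvalue (Fintype.card 𝔽) x (pivots Y) := by
  have hq : (Fintype.card 𝔽 : K) - 1 ≠ 0 := by
    rw [sub_ne_zero]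
    exact_mod_cast (Fintype.one_lt_card (α := 𝔽)).ne'
  have hq0 : (Fintype.card 𝔽 : K) ≠ 0 := by exact_mod_cast Fintype.card_ne_zero
  simp only [subspaceWeight, vecWeight]
  rw [Finset.sum_comm, eigenvalue, ← Finset.sum_filter_add_sum_filter_not _ (· ∈ pivots Y),
    Finset.filter_mem_eq_inter, Finset.univ_inter, add_eq_left.2]
  · refine Finset.sum_congr rfl fun i hi => ?_
    rw [← Finset.sum_filter, Finset.filter_filter, Finset.sum_const, nsmul_eq_mul]
    have h := congrArg (fun r : ℚ => (r : K)) (card_leads hi)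
    push_cast at h
    -- The power `position - 1` counts the vectors of `Y` leading at `i` and cancels against the
    -- weight; `expo` is what remains.
    have e : n - ((i : ℕ) + 1) = expo (pivots Y) i + (position (pivots Y) i - 1) := by
      have h1 := position_le (S := pivots Y) i
      have h2 := position_pos hi
      rw [expo]
      omega
    rw [h, e, pow_add]
    field_simp
  · refine Finset.sum_eq_zero fun i hi => Finset.sum_eq_zero fun v hv => if_neg fun h => ?_
    exact (Finset.mem_filter.1 hi).2 (mem_pivots.2 ⟨v, (Finset.mem_filter.1 hv).2, h⟩)

/-- The number of subspaces with given pivots. -/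
def pivotCount (𝔽 : Type*) [Field 𝔽] [Fintype 𝔽] {n : ℕ} (S : Finset (Fin n)) : ℕ :=
  (Finset.univ.filter fun Y : Submodule 𝔽 (Fin n → 𝔽) => pivots Y = S).card

/-- With `a` below all of `S`, cutting with `tail (a + 1)` removes the pivot `a`, and adding any
vector led by `a` restores it. Recording the vector makes this a bijection. -/
theorem card_pairs_insert {S : Finset (Fin n)} {a : Fin n} (ha : ∀ i ∈ S, a < i) :
    ((Finset.univ.filter fun Y : Submodule 𝔽 (Fin n → 𝔽) =>
      pivots Y = Insert.insert a S).sigma fun Y =>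
        Finset.univ.filter fun v : Fin n → 𝔽 => v ∈ Y ∧ Leads v a).card =
    ((Finset.univ.filter fun Y : Submodule 𝔽 (Fin n → 𝔽) => pivots Y = S).sigma fun _ =>
        Finset.univ.filter fun v : Fin n → 𝔽 => v ∈ (⊤ : Submodule 𝔽 (Fin n → 𝔽)) ∧
          Leads v a).card := by
  refine Finset.card_nbij' (fun p => ⟨p.1 ⊓ tail 𝔽 n (a + 1), p.2⟩)
    (fun p => ⟨p.1 ⊔ span 𝔽 {p.2}, p.2⟩) ?_ ?_ ?_ ?_
  · rintro ⟨Y, v⟩ h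
    simp only [Finset.coe_sigma, Finset.mem_coe, Set.mem_sigma_iff,
      Finset.mem_filter, Finset.mem_univ, true_and,
      mem_top] at h ⊢
    refine ⟨?_, h.2.2⟩
    rw [pivots_inf_tail, h.1, Finset.filter_insert, if_neg (by omega), Finset.filter_true_of_mem]
    exact fun i hi => ha i hi
  · rintro ⟨Y, v⟩ h
    simp only [Finset.coe_sigma, Finset.mem_coe, Set.mem_sigma_iff,
      Finset.mem_filter, Finset.mem_univ, true_and,
      mem_top] at h ⊢
    refine ⟨?_, mem_sup_right (mem_span_singleton_self v), h.2⟩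
    rw [pivots_sup_span (le_tail_of_lt_pivots fun i hi => ha i (h.1 ▸ hi)) h.2, h.1]
  · rintro ⟨Y, v⟩ h
    simp only [Finset.coe_sigma, Finset.mem_coe, Set.mem_sigma_iff,
      Finset.mem_filter, Finset.mem_univ, true_and] at h
    simp only
    have hle : Y ≤ tail 𝔽 n a := le_tail_of_lt_pivots fun i hi => by
      rw [h.1, Finset.mem_insert] at hi
      rcases hi with rfl | hi
      · exact le_rfl
      · exact (ha i hi).le
    rw [← inf_tail_eq_sup h.2.1 h.2.2, inf_eq_left.2 hle]
  · rintro ⟨Y, v⟩ h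
    simp only [Finset.coe_sigma, Finset.mem_coe, Set.mem_sigma_iff,
      Finset.mem_filter, Finset.mem_univ, true_and,
      mem_top] at h
    simp only
    rw [sup_span_inf_tail (le_tail_of_lt_pivots fun i hi => ha i (h.1 ▸ hi)) h.2]

theorem position_univ (i : Fin n) : position Finset.univ i = n - i := by
  have : (Finset.univ.filter fun t : Fin n => i ≤ t) = Finset.Ici i := by ext; simp
  rw [position, this, Fin.card_Ici]

theorem pivotCount_insert {S : Finset (Fin n)} {a : Fin n} (ha : ∀ i ∈ S, a < i) :
    pivotCount 𝔽 (Insert.insert a S) =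
      pivotCount 𝔽 S * Fintype.card 𝔽 ^ expo (Insert.insert a S) a := by
  have h := congrArg (fun m : ℕ => (m : ℚ)) (card_pairs_insert (𝔽 := 𝔽) ha)
  have hpos : position (Insert.insert a S) a = S.card + 1 := by
    rw [position, Finset.filter_true_of_mem, Finset.card_insert_of_notMem]
    · exact fun h => lt_irrefl a (ha a h)
    · intro i hi
      rcases Finset.mem_insert.1 hi with rfl | hi
      · exact le_rfl
      · exact (ha i hi).le
  simp only [Finset.card_sigma] at h
  push_cast at h
  rw [Finset.sum_eq_card_nsmul (b := (Fintype.card 𝔽 : ℚ) ^ S.card * ((Fintype.card 𝔽 : ℚ) - 1)),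
    Finset.sum_eq_card_nsmul (b := (Fintype.card 𝔽 : ℚ) ^ (n - a - 1) *
      ((Fintype.card 𝔽 : ℚ) - 1))] at h
  · rw [nsmul_eq_mul, nsmul_eq_mul, ← mul_assoc, ← mul_assoc] at h
    have hq := one_lt_card_rat (𝔽 := 𝔽)
    have h := mul_right_cancel₀ (by linarith : (Fintype.card 𝔽 : ℚ) - 1 ≠ 0) h
    have e : n - a - 1 = expo (Insert.insert a S) a + S.card := by
      have := position_le (S := Insert.insert a S) a
      rw [expo, hpos]
      omega
    rw [e, pow_add, ← mul_assoc] at h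
    have h := mul_right_cancel₀ (pow_ne_zero _ (by linarith)) h
    exact_mod_cast h
  · intro Y _
    rw [card_leads (by simp [pivots_top]), pivots_top, position_univ]
  · intro Y hY
    have hY := (Finset.mem_filter.1 hY).2
    rw [card_leads (by simp [hY]), hY, hpos, Nat.add_sub_cancel]

/-- Pivots are added from the largest down: `position` counts only elements to the right, so a new
minimum leaves the other exponents unchanged. -/
theorem pivotCount_eq (S : Finset (Fin n)) :
    pivotCount 𝔽 S = Fintype.card 𝔽 ^ ∑ i ∈ S, expo S i := by
  induction S using Finset.induction_on_min with
  | empty =>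
    rw [Finset.sum_empty, pow_zero, pivotCount, Finset.card_eq_one]
    refine ⟨⊥, ?_⟩
    ext Y
    rw [Finset.mem_filter, Finset.mem_singleton, ← Finset.card_eq_zero, ← finrank_eq_card_pivots,
      Submodule.finrank_eq_zero]
    simp
  | insert a S ha ih =>
    have haS : a ∉ S := fun h => lt_irrefl a (ha a h)
    rw [pivotCount_insert ha, ih, Finset.sum_insert haS, ← pow_add, add_comm]
    congr 2
    refine Finset.sum_congr rfl fun i hi => ?_
    rw [expo, expo, position, position, Finset.filter_insert, if_neg (not_le.2 (ha i hi))]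

/-- The separate case `|S| = n` agrees with the general formula, as `d_0 = 1` and all exponents
vanish. -/
theorem natDerangement_mul_pow_eq_multiplicity (q : ℕ) (S : Finset (Fin n)) :
    ((natDerangement q (n - S.card) * q ^ ∑ i ∈ S, expo S i : ℕ) : ℚ) = multiplicity q S := by
  rw [multiplicity, Nat.cast_mul, natDerangement_cast, Nat.cast_pow]
  split_ifs with h
  · have hS : S = Finset.univ := Finset.eq_univ_of_card _ (by rw [h, Fintype.card_fin])
    have h0 : ∑ i ∈ S, expo S i = 0 := Finset.sum_eq_zero fun i _ => by
      have := i.2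
      rw [hS, expo, position_univ]
      omega
    rw [h0, h, Nat.sub_self, qDerangement_zero, pow_zero, mul_one]
  · rfl

theorem charpoly_walk_vecWeight {K : Type*} [Field K] [CharZero K] (x : Fin n → K) :
    (walk (vecWeight (𝔽 := 𝔽) x)).charpoly = ∏ S : Finset (Fin n),
      (Polynomial.X - Polynomial.C (eigenvalue (Fintype.card 𝔽) x S)) ^
        (natDerangement (Fintype.card 𝔽) (n - S.card) *
          Fintype.card 𝔽 ^ ∑ i ∈ S, expo S i) := by
  apply charpoly_eq_of_trace_pow
  intro t
  rw [trace_walk_pow, ← Finset.sum_fiberwise_of_maps_to (t := Finset.univ) (g := pivots)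
    fun _ _ => Finset.mem_univ _]
  refine Finset.sum_congr rfl fun S _ => ?_
  rw [Finset.sum_eq_card_nsmul (b := (natDerangement (Fintype.card 𝔽) (n - S.card) : K) *
    eigenvalue (Fintype.card 𝔽) x S ^ t)]
  · rw [nsmul_eq_mul, ← pivotCount_eq, pivotCount]
    push_cast
    ring
  · intro Y hY
    rw [subspaceWeight_vecWeight, finrank_eq_card_pivots, (Finset.mem_filter.1 hY).2]

theorem vecWeight_nonneg {x : Fin n → ℝ} (hx : ∀ i, 0 ≤ x i) (v : Fin n → 𝔽) :
    0 ≤ vecWeight x v := by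
  have : (1 : ℝ) ≤ Fintype.card 𝔽 := by exact_mod_cast Fintype.card_pos
  refine Finset.sum_nonneg fun i _ => ?_
  split_ifs
  · exact div_nonneg (div_nonneg (hx i) (by positivity)) (by linarith)
  · exact le_rfl

theorem isDiagonalizable_tsetlin_of_nonneg {x : Fin n → ℝ} (hx : ∀ i, 0 ≤ x i) :
    IsDiagonalizable (tsetlin 𝔽 x) := by
  rw [tsetlin_eq_sum]
  refine isDiagonalizable_walk fun X Y hXY h v hvY hvX => ?_
  have hsub : (Finset.univ.filter fun v => v ∈ X) ⊆ Finset.univ.filter fun v => v ∈ Y :=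
    Finset.monotone_filter_right _ fun v _ hv => hXY hv
  rw [subspaceWeight, subspaceWeight, ← Finset.sum_sdiff hsub, right_eq_add,
    Finset.sum_eq_zero_iff_of_nonneg fun v _ => vecWeight_nonneg hx v] at h
  exact h v (by simp [hvY, hvX])

/-- The eigenvalue is a linear form whose variables with nonzero coefficient are exactly those
indexed by `S`. -/
theorem eigenvalue_injective_of_indeterminates {q : ℕ} (hq : q ≠ 0) :
    Function.Injective (eigenvalue (n := n) (K := FractionRing (MvPolynomial (Fin n) ℂ)) q
      fun i => algebraMap (MvPolynomial (Fin n) ℂ) _ (MvPolynomial.X i)) := by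
  let p : Finset (Fin n) → MvPolynomial (Fin n) ℂ := fun S =>
    ∑ i ∈ S, MvPolynomial.C (((q : ℂ) ^ expo S i)⁻¹) * MvPolynomial.X i
  have hq' : (q : ℂ) ≠ 0 := by exact_mod_cast hq
  have hp : ∀ S, eigenvalue (n := n) (K := FractionRing (MvPolynomial (Fin n) ℂ)) q
      (fun i => algebraMap (MvPolynomial (Fin n) ℂ) _ (MvPolynomial.X i)) S =
      algebraMap _ _ (p S) := by
    intro S
    rw [eigenvalue, map_sum]
    refine Finset.sum_congr rfl fun i _ => ?_
    have h0 : (q : FractionRing (MvPolynomial (Fin n) ℂ)) ^ expo S i ≠ 0 :=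
      pow_ne_zero _ (by exact_mod_cast hq)
    rw [div_eq_iff h0, map_mul, mul_right_comm]
    have : (q : FractionRing (MvPolynomial (Fin n) ℂ)) ^ expo S i =
        algebraMap (MvPolynomial (Fin n) ℂ) _ (MvPolynomial.C ((q : ℂ) ^ expo S i)) := by simp
    rw [this, ← map_mul, ← map_mul, ← MvPolynomial.C_mul, inv_mul_cancel₀ (pow_ne_zero _ hq'),
      MvPolynomial.C_1, one_mul]
  have hcoeff : ∀ S i, (p S).coeff (Finsupp.single i 1) =
      if i ∈ S then ((q : ℂ) ^ expo S i)⁻¹ else 0 := by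
    intro S i
    simp [p, MvPolynomial.coeff_sum, MvPolynomial.coeff_C_mul, MvPolynomial.coeff_X,
      Finsupp.single_left_inj]
  intro S S' h
  simp only [hp] at h
  have h := IsFractionRing.injective (MvPolynomial (Fin n) ℂ) _ h
  ext i
  have hi := congrArg (MvPolynomial.coeff (Finsupp.single i 1)) h
  rw [hcoeff, hcoeff] at hi
  have hne : ∀ e : ℕ, ((q : ℂ) ^ e)⁻¹ ≠ 0 := fun e => inv_ne_zero (pow_ne_zero e hq')
  constructor <;> intro hmem <;> by_contra hnot
  · rw [if_pos hmem, if_neg hnot] at hi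
    exact hne _ hi
  · rw [if_neg hnot, if_pos hmem] at hi
    exact hne _ hi.symm

theorem isDiagonalizable_tsetlin_of_indeterminates :
    IsDiagonalizable (tsetlin 𝔽 (K := FractionRing (MvPolynomial (Fin n) ℂ))
      fun i => algebraMap (MvPolynomial (Fin n) ℂ) _ (MvPolynomial.X i)) := by
  have : CharZero (FractionRing (MvPolynomial (Fin n) ℂ)) :=
    charZero_of_injective_algebraMap
      (IsFractionRing.injective (MvPolynomial (Fin n) ℂ) (FractionRing (MvPolynomial (Fin n) ℂ)))
  rw [tsetlin_eq_sum]
  refine isDiagonalizable_walk fun X Y hXY h v hvY hvX => ?_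
  rw [subspaceWeight_vecWeight, subspaceWeight_vecWeight] at h
  have hpiv := eigenvalue_injective_of_indeterminates Fintype.card_ne_zero h
  -- Equal weights force equal pivots, hence equal dimensions, so no vector of `Y` lies outside `X`.
  have : X = Y := Submodule.eq_of_le_of_finrank_eq hXY (by
    rw [finrank_eq_card_pivots, finrank_eq_card_pivots, hpiv])
  exact absurd (this ▸ hvY) hvX

end Pivots

end

end QTsetlin

theorem mainTheorem3 {𝔽 : Type*} [Field 𝔽] [Fintype 𝔽] (n : ℕ) :
    -- the multiplicities are natural numbers, and they give the spectrum for all weights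
    (∃ m : Finset (Fin n) → ℕ,
      (∀ S, (m S : ℚ) = QTsetlin.multiplicity (Fintype.card 𝔽) S) ∧
      ∀ (K : Type*) [Field K] [CharZero K] (x : Fin n → K),
        (QTsetlin.tsetlin 𝔽 x).charpoly =
          ∏ S : Finset (Fin n),
            (Polynomial.X - Polynomial.C (QTsetlin.eigenvalue (Fintype.card 𝔽) x S)) ^ m S) ∧
    -- diagonalizability for nonnegative real weights
    (∀ x : Fin n → ℝ, (∀ i, 0 ≤ x i) → QTsetlin.IsDiagonalizable (QTsetlin.tsetlin 𝔽 x)) ∧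
    -- diagonalizability for indeterminate weights, over the field of rational functions
    QTsetlin.IsDiagonalizable
      (QTsetlin.tsetlin 𝔽 (K := FractionRing (MvPolynomial (Fin n) ℂ))
        fun i => algebraMap (MvPolynomial (Fin n) ℂ) _ (MvPolynomial.X i)) := by
  refine ⟨⟨fun S => QTsetlin.natDerangement (Fintype.card 𝔽) (n - S.card) *
    Fintype.card 𝔽 ^ ∑ i ∈ S, QTsetlin.expo S i,
    QTsetlin.natDerangement_mul_pow_eq_multiplicity _, fun K _ _ x => ?_⟩,
    fun x hx => QTsetlin.isDiagonalizable_tsetlin_of_nonneg hx,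
    QTsetlin.isDiagonalizable_tsetlin_of_indeterminates⟩
  rw [QTsetlin.tsetlin_eq_sum]
  exact QTsetlin.charpoly_walk_vecWeight x
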